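/- Let $N\ge 1$ be an integer and let $q\in\mathbb C$ be a primitive $N$-th root of unity. Let $C^\infty(T^2_q)$ denote the smooth noncommutative torus: the unital complex algebra of all formal series $f=\sum_{(k,l)\in\mathbb Z^2} f_{k,l}\,U^kV^l$ whose coefficients $f_{k,l}\in\mathbb C$ are rapidly decreasing, i.e. $\sup_{k,l}|f_{k,l}|\,(1+|k|+|l|)^m<\infty$ for every $m\in\mathbb N$, with the multiplication determined by $UV=q\,VU$, that is $$fg=\sum_{k,l}\Bigl(\sum_{m,n} f_{m,n}\,g_{k-m,\,l-n}\,q^{-n(k-m)}\Bigr)U^kV^l .$$ Let $C^\infty(T^2)=C^\infty(S^1\times S^1,\mathbb C)$ be the commutative algebra of smooth complex-valued functions on the torus, with pointwise operations. Then the $\mathbb C$-algebras $C^\infty(T^2_q)$ and $C^\infty(T^2)$ are Morita equivalent, i.e. their categories of modules are equivalent as $\mathbb C$-linear categories. -/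

import Mathlib

open scoped Manifold ContDiff

noncomputable section

namespace NCT

/-- The weight `1 + |k| + |l|` of the index `(k, l)`. -/
def weight (x : ℤ × ℤ) : ℝ := 1 + |(x.1 : ℝ)| + |(x.2 : ℝ)|

/-- A double sequence `a` is rapidly decreasing if, for each `m`, the quantity
`sup_{k,l} |a (k, l)| (1 + |k| + |l|) ^ m` is finite. -/
def IsRapid (a : ℤ × ℤ → ℂ) : Prop :=
  ∀ m : ℕ, BddAbove (Set.range fun x => ‖a x‖ * weight x ^ m)

theorem isRapid_iff {a : ℤ × ℤ → ℂ} :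
    IsRapid a ↔ ∀ m : ℕ, ∃ C : ℝ, ∀ x, ‖a x‖ * weight x ^ m ≤ C := by
  simp only [IsRapid, BddAbove, Set.Nonempty, mem_upperBounds, Set.forall_mem_range]

theorem one_le_weight (x : ℤ × ℤ) : 1 ≤ weight x := by
  unfold weight
  linarith [abs_nonneg (x.1 : ℝ), abs_nonneg (x.2 : ℝ)]

theorem weight_pos (x : ℤ × ℤ) : 0 < weight x := zero_lt_one.trans_le (one_le_weight x)

theorem weight_le_mul (x y : ℤ × ℤ) : weight x ≤ weight y * weight (x - y) := by
  have h1 : |(x.1 : ℝ)| ≤ |(y.1 : ℝ)| + |((x - y).1 : ℝ)| := by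
    have := abs_add_le (y.1 : ℝ) ((x - y).1 : ℝ)
    simpa using this
  have h2 : |(x.2 : ℝ)| ≤ |(y.2 : ℝ)| + |((x - y).2 : ℝ)| := by
    have := abs_add_le (y.2 : ℝ) ((x - y).2 : ℝ)
    simpa using this
  unfold weight
  have a1 := abs_nonneg (y.1 : ℝ)
  have a2 := abs_nonneg (y.2 : ℝ)
  have a3 := abs_nonneg ((x - y).1 : ℝ)
  have a4 := abs_nonneg ((x - y).2 : ℝ)
  nlinarith [mul_nonneg a1 a3, mul_nonneg a1 a4, mul_nonneg a2 a3, mul_nonneg a2 a4]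

/-- The complex vector space of rapidly decreasing double sequences. -/
def rapid : Submodule ℂ (ℤ × ℤ → ℂ) where
  carrier := {a | IsRapid a}
  zero_mem' := isRapid_iff.2 fun m => ⟨0, fun x => by simp⟩
  add_mem' := by
    intro a b ha hb
    refine isRapid_iff.2 fun m => ?_
    obtain ⟨C, hC⟩ := isRapid_iff.1 ha m
    obtain ⟨D, hD⟩ := isRapid_iff.1 hb m
    refine ⟨C + D, fun x => ?_⟩
    have hw : 0 ≤ weight x ^ m := (pow_pos (weight_pos x) m).le
    calc ‖(a + b) x‖ * weight x ^ m ≤ (‖a x‖ + ‖b x‖) * weight x ^ m :=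
          mul_le_mul_of_nonneg_right (norm_add_le _ _) hw
      _ ≤ C + D := by rw [add_mul]; exact add_le_add (hC x) (hD x)
  smul_mem' := by
    intro c a ha
    refine isRapid_iff.2 fun m => ?_
    obtain ⟨C, hC⟩ := isRapid_iff.1 ha m
    refine ⟨‖c‖ * C, fun x => ?_⟩
    rw [Pi.smul_apply, norm_smul, mul_assoc]
    exact mul_le_mul_of_nonneg_left (hC x) (norm_nonneg c)

theorem summable_int : Summable fun k : ℤ => ((1 + |(k : ℝ)|) ^ 2)⁻¹ := by
  refine Summable.of_norm_bounded_eventually (g := fun k : ℤ => 1 / (k : ℝ) ^ 2)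
    (Real.summable_one_div_int_pow.2 one_lt_two) ?_
  filter_upwards [(Set.finite_singleton (0 : ℤ)).compl_mem_cofinite] with k hk
  have hk0 : (k : ℝ) ≠ 0 := by exact_mod_cast hk
  rw [Real.norm_of_nonneg (by positivity), one_div]
  apply inv_anti₀ (by positivity)
  rw [← sq_abs (k : ℝ)]
  gcongr
  linarith

theorem summable_weight : Summable fun x : ℤ × ℤ => (weight x ^ 4)⁻¹ := by
  refine Summable.of_nonneg_of_le (fun x => (inv_pos.2 (pow_pos (weight_pos x) 4)).le)
    (fun x => ?_) (summable_int.mul_of_nonneg summable_int (fun k => by positivity)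
      (fun k => by positivity))
  rw [← mul_inv]
  apply inv_anti₀ (by positivity)
  have h1 : 1 + |(x.1 : ℝ)| ≤ weight x := by unfold weight; linarith [abs_nonneg (x.2 : ℝ)]
  have h2 : 1 + |(x.2 : ℝ)| ≤ weight x := by unfold weight; linarith [abs_nonneg (x.1 : ℝ)]
  calc (1 + |(x.1 : ℝ)|) ^ 2 * (1 + |(x.2 : ℝ)|) ^ 2 ≤ weight x ^ 2 * weight x ^ 2 := by gcongr
    _ = weight x ^ 4 := by ring

theorem summable_mul_weight {a : ℤ × ℤ → ℂ} (ha : IsRapid a) (m : ℕ) :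
    Summable fun x => ‖a x‖ * weight x ^ m := by
  obtain ⟨C, hC⟩ := isRapid_iff.1 ha (m + 4)
  refine Summable.of_nonneg_of_le
    (fun x => mul_nonneg (norm_nonneg _) (pow_pos (weight_pos x) m).le) (fun x => ?_)
    (summable_weight.mul_left C)
  rw [← div_eq_mul_inv, le_div_iff₀ (pow_pos (weight_pos x) 4), mul_assoc, ← pow_add]
  exact hC x

theorem summable_norm {a : ℤ × ℤ → ℂ} (ha : IsRapid a) : Summable fun x => ‖a x‖ := by
  simpa using summable_mul_weight ha 0

theorem norm_le {a : ℤ × ℤ → ℂ} (ha : IsRapid a) : ∃ C : ℝ, ∀ x, ‖a x‖ ≤ C := by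
  simpa using isRapid_iff.1 ha 0

/-- The factor in `U^k V^l U^m V^n = q^(-l m) U^(k+m) V^(l+n)`, for `x = (k, l)`, `y = (m, n)`. -/
def phase (q : Circle) (x y : ℤ × ℤ) : ℂ := ((q ^ (-(x.2 * y.1)) : Circle) : ℂ)

theorem norm_phase (q : Circle) (x y : ℤ × ℤ) : ‖phase q x y‖ = 1 := Circle.norm_coe _

theorem phase_mul_phase (q : Circle) (x y z : ℤ × ℤ) :
    phase q x y * phase q (x + y) z = phase q x (y + z) * phase q y z := by
  unfold phase
  rw [← Circle.coe_mul, ← Circle.coe_mul, ← zpow_add, ← zpow_add]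
  congr 2
  simp only [Prod.fst_add, Prod.snd_add]
  ring

/-- The product of the formal series `∑ a (k, l) U^k V^l` and `∑ b (k, l) U^k V^l` where
`U V = q V U`; its coefficient at `(k, l)` is
`∑_{m,n} a (m, n) b (k - m, l - n) q^(-n (k - m))`. -/
def twistedConv (q : Circle) (a b : ℤ × ℤ → ℂ) : ℤ × ℤ → ℂ :=
  fun x => ∑' y : ℤ × ℤ, a y * b (x - y) * phase q y (x - y)

theorem norm_term (q : Circle) (a b : ℤ × ℤ → ℂ) (x y : ℤ × ℤ) :
    ‖a y * b (x - y) * phase q y (x - y)‖ = ‖a y‖ * ‖b (x - y)‖ := by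
  rw [norm_mul, norm_mul, norm_phase, mul_one]

theorem summable_norm_term (q : Circle) {a b : ℤ × ℤ → ℂ} (ha : IsRapid a) (hb : IsRapid b)
    (x : ℤ × ℤ) : Summable fun y => ‖a y * b (x - y) * phase q y (x - y)‖ := by
  obtain ⟨C, hC⟩ := norm_le hb
  refine Summable.of_nonneg_of_le (fun y => norm_nonneg _) (fun y => ?_)
    ((summable_norm ha).mul_right C)
  rw [norm_term]
  exact mul_le_mul_of_nonneg_left (hC _) (norm_nonneg _)

theorem summable_term (q : Circle) {a b : ℤ × ℤ → ℂ} (ha : IsRapid a) (hb : IsRapid b)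
    (x : ℤ × ℤ) : Summable fun y => a y * b (x - y) * phase q y (x - y) :=
  (summable_norm_term q ha hb x).of_norm

theorem isRapid_twistedConv (q : Circle) {a b : ℤ × ℤ → ℂ} (ha : IsRapid a) (hb : IsRapid b) :
    IsRapid (twistedConv q a b) := by
  refine isRapid_iff.2 fun m => ?_
  obtain ⟨C, hC⟩ := isRapid_iff.1 hb m
  have hs := (summable_mul_weight ha m).mul_right C
  refine ⟨∑' y, ‖a y‖ * weight y ^ m * C, fun x => ?_⟩
  have hn := summable_norm_term q ha hb x
  calc ‖twistedConv q a b x‖ * weight x ^ m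
      ≤ (∑' y, ‖a y * b (x - y) * phase q y (x - y)‖) * weight x ^ m :=
        mul_le_mul_of_nonneg_right (norm_tsum_le_tsum_norm hn) (pow_pos (weight_pos x) m).le
    _ = ∑' y, ‖a y * b (x - y) * phase q y (x - y)‖ * weight x ^ m := tsum_mul_right.symm
    _ ≤ ∑' y, ‖a y‖ * weight y ^ m * C := by
        refine (hn.mul_right _).tsum_le_tsum (fun y => ?_) hs
        rw [norm_term]
        have h1 : weight x ^ m ≤ weight y ^ m * weight (x - y) ^ m := by
          rw [← mul_pow]
          exact pow_le_pow_left₀ (weight_pos x).le (weight_le_mul x y) m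
        calc ‖a y‖ * ‖b (x - y)‖ * weight x ^ m
            ≤ ‖a y‖ * ‖b (x - y)‖ * (weight y ^ m * weight (x - y) ^ m) :=
              mul_le_mul_of_nonneg_left h1 (mul_nonneg (norm_nonneg _) (norm_nonneg _))
          _ = ‖a y‖ * weight y ^ m * (‖b (x - y)‖ * weight (x - y) ^ m) := by ring
          _ ≤ ‖a y‖ * weight y ^ m * C :=
              mul_le_mul_of_nonneg_left (hC _)
                (mul_nonneg (norm_nonneg _) (pow_pos (weight_pos y) m).le)

theorem twistedConv_assoc (q : Circle) {a b c : ℤ × ℤ → ℂ} (ha : IsRapid a) (hb : IsRapid b)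
    (hc : IsRapid c) :
    twistedConv q (twistedConv q a b) c = twistedConv q a (twistedConv q b c) := by
  funext x
  -- the common summand, with the indices of the three factors `z`, `w`, `x - z - w`
  let F : ℤ × ℤ → ℤ × ℤ → ℂ := fun z w =>
    a z * (b w * c (x - z - w) * phase q w (x - z - w)) * phase q z (x - z)
  have hF : Summable (Function.uncurry F) := by
    obtain ⟨C, hC⟩ := norm_le hc
    refine Summable.of_norm_bounded (g := fun p : (ℤ × ℤ) × (ℤ × ℤ) => ‖a p.1‖ * ‖b p.2‖ * C)
      (((summable_norm ha).mul_of_nonneg (summable_norm hb) (fun _ => norm_nonneg _)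
        (fun _ => norm_nonneg _)).mul_right C) ?_
    rintro ⟨z, w⟩
    simp only [Function.uncurry, F, norm_mul, norm_phase, mul_one]
    rw [← mul_assoc]
    exact mul_le_mul_of_nonneg_left (hC _) (mul_nonneg (norm_nonneg _) (norm_nonneg _))
  let e : (ℤ × ℤ) × (ℤ × ℤ) ≃ (ℤ × ℤ) × (ℤ × ℤ) :=
    { toFun := fun p => (p.1, p.2 - p.1)
      invFun := fun p => (p.1, p.2 + p.1)
      left_inv := fun p => by simp
      right_inv := fun p => by simp }
  have hG : Summable (Function.uncurry fun z y => F z (y - z)) := e.summable_iff.2 hF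
  have hR : twistedConv q a (twistedConv q b c) x = ∑' z, ∑' w, F z w := by
    simp only [twistedConv, F]
    refine tsum_congr fun z => ?_
    rw [tsum_mul_right, tsum_mul_left]
  have hL : twistedConv q (twistedConv q a b) c x = ∑' y, ∑' z, F z (y - z) := by
    simp only [twistedConv]
    refine tsum_congr fun y => ?_
    rw [← tsum_mul_right, ← tsum_mul_right]
    refine tsum_congr fun z => ?_
    have h := phase_mul_phase q z (y - z) (x - y)
    rw [add_sub_cancel, sub_add_sub_cancel'] at h
    have h1 : x - z - (y - z) = x - y := by abel
    simp only [F, h1]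
    have h2 : y - z + (x - y) = x - z := by abel
    linear_combination (a z * b (y - z) * c (x - y)) * h
  rw [hL, hR, hG.tsum_comm]
  refine tsum_congr fun z => ?_
  exact (Equiv.subRight z).tsum_eq (F z)

/-- The smooth noncommutative torus `C^∞(T²_q)`: formal series `∑ a (k, l) U^k V^l` with
rapidly decreasing coefficients, represented by the coefficients. -/
def SmoothQTorus (_q : Circle) : Type := rapid

namespace SmoothQTorus

variable {q : Circle}

instance : AddCommGroup (SmoothQTorus q) := inferInstanceAs (AddCommGroup rapid)

instance : Module ℂ (SmoothQTorus q) := inferInstanceAs (Module ℂ rapid)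

/-- The coefficients of an element of the noncommutative torus. -/
def coeff (f : SmoothQTorus q) : ℤ × ℤ → ℂ := Subtype.val (p := (· ∈ rapid)) f

theorem isRapid_coeff (f : SmoothQTorus q) : IsRapid f.coeff := Subtype.prop (p := (· ∈ rapid)) f

/-- The element with given rapidly decreasing coefficients. -/
def mk (a : ℤ × ℤ → ℂ) (ha : IsRapid a) : SmoothQTorus q := (⟨a, ha⟩ : rapid)

@[simp] theorem coeff_mk (a : ℤ × ℤ → ℂ) (ha : IsRapid a) :
    (mk a ha : SmoothQTorus q).coeff = a := rfl

@[ext] theorem ext {f g : SmoothQTorus q} (h : ∀ x, f.coeff x = g.coeff x) : f = g :=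
  Subtype.ext (p := (· ∈ rapid)) (funext h)

@[simp] theorem coeff_zero : (0 : SmoothQTorus q).coeff = 0 := rfl

@[simp] theorem coeff_add (f g : SmoothQTorus q) : (f + g).coeff = f.coeff + g.coeff := rfl

@[simp] theorem coeff_smul (c : ℂ) (f : SmoothQTorus q) : (c • f).coeff = c • f.coeff := rfl

/-- The monomial `U^k V^l` for `x = (k, l)`. -/
def monomial (x : ℤ × ℤ) : SmoothQTorus q :=
  mk (Pi.single x 1) (isRapid_iff.2 fun m => ⟨weight x ^ m, fun y => by
    by_cases h : y = x
    · subst h; simp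
    · simp [h, (pow_pos (weight_pos x) m).le]⟩)

instance : One (SmoothQTorus q) := ⟨monomial 0⟩

instance : Mul (SmoothQTorus q) :=
  ⟨fun f g => mk (twistedConv q f.coeff g.coeff)
    (isRapid_twistedConv q f.isRapid_coeff g.isRapid_coeff)⟩

theorem coeff_one : (1 : SmoothQTorus q).coeff = Pi.single 0 1 := rfl

theorem coeff_mul (f g : SmoothQTorus q) : (f * g).coeff = twistedConv q f.coeff g.coeff := rfl

instance : Ring (SmoothQTorus q) :=
  { (inferInstance : AddCommGroup (SmoothQTorus q)) with
    mul_assoc := fun f g h => by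
      ext x
      exact congrFun (twistedConv_assoc q f.isRapid_coeff g.isRapid_coeff h.isRapid_coeff) x
    one_mul := fun f => by
      ext x
      rw [coeff_mul, coeff_one, twistedConv, tsum_eq_single 0 fun y hy => by simp [hy]]
      simp [phase]
    mul_one := fun f => by
      ext x
      rw [coeff_mul, coeff_one, twistedConv, tsum_eq_single x fun y hy => by
        simp [sub_ne_zero.2 hy.symm]]
      simp [phase]
    zero_mul := fun f => by ext x; simp [coeff_mul, twistedConv]
    mul_zero := fun f => by ext x; simp [coeff_mul, twistedConv]
    left_distrib := fun f g h => by
      ext x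
      simp only [coeff_mul, coeff_add, Pi.add_apply, twistedConv]
      rw [← (summable_term q f.isRapid_coeff g.isRapid_coeff x).tsum_add
        (summable_term q f.isRapid_coeff h.isRapid_coeff x)]
      exact tsum_congr fun y => by ring
    right_distrib := fun f g h => by
      ext x
      simp only [coeff_mul, coeff_add, Pi.add_apply, twistedConv]
      rw [← (summable_term q f.isRapid_coeff h.isRapid_coeff x).tsum_add
        (summable_term q g.isRapid_coeff h.isRapid_coeff x)]
      exact tsum_congr fun y => by ring }

instance : Algebra ℂ (SmoothQTorus q) :=
  Algebra.ofModule
    (fun c f g => by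
      ext x
      simp only [coeff_mul, coeff_smul, Pi.smul_apply, twistedConv, smul_eq_mul]
      rw [← tsum_mul_left]
      exact tsum_congr fun y => by ring)
    (fun c f g => by
      ext x
      simp only [coeff_mul, coeff_smul, Pi.smul_apply, twistedConv, smul_eq_mul]
      rw [← tsum_mul_left]
      exact tsum_congr fun y => by ring)

end SmoothQTorus

/-- Addition and multiplication of `ℂ`, as a real manifold, are smooth. -/
instance : ContMDiffRing 𝓘(ℝ, ℂ) ∞ ℂ :=
  { instNormedSpaceLieAddGroup with
    contMDiff_mul := by
      rw [contMDiff_iff]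
      refine ⟨continuous_mul, fun x y => ?_⟩
      simp only [mfld_simps, chartAt_self_eq]
      rw [contDiffOn_univ]
      exact contDiff_mul }

/-- The algebra `C^∞(S¹ × S¹, ℂ)` of smooth complex-valued functions on the torus, with the
pointwise operations. -/
abbrev SmoothTorus : Type :=
  C^∞⟮(𝓡 1).prod (𝓡 1), Circle × Circle; 𝓘(ℝ, ℂ), ℂ⟯

/-- Complex numbers act on `C^∞(S¹ × S¹, ℂ)` as constant functions. -/
instance : Algebra ℂ SmoothTorus :=
  RingHom.toAlgebra
    { toFun := fun c => ContMDiffMap.const c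
      map_one' := rfl
      map_mul' := fun _ _ => rfl
      map_zero' := rfl
      map_add' := fun _ _ => rfl }

end NCT

end

/-!
# Rational smooth noncommutative tori are Morita equivalent to the torus

Write `q = exp (2πib/N)` with `b` prime to `N`, choose `a` with `ab ≡ 1` modulo `N`, and consider
the line bundle of degree `a` on the torus. Its sections are smooth functions `f` on the plane with
`f(s + 1, t) = f(s, t)` and `f(s, t + 1) = exp (2πias) f(s, t)`. On them
`U f(s, t) = exp (2πis) f(s, t)` and `V f(s, t) = exp (2πit/N) f(s - b/N, t)` are well defined, the
latter because `ab ≡ 1`, and `U V = q V U`. So the noncommutative torus acts, and it commutes with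
the multiplication by functions of `(Ns, t)`, that is, by functions on the base of the covering
`(u, w) ↦ (u ^ N, w)` of the torus by itself. Over the base, the sections form a vector bundle of
rank `N`, and the action identifies the noncommutative torus with its endomorphism algebra: this
is the Morita equivalence.

The proof has three ingredients.

* The algebraic criterion `IsMoritaEquivalent.of_bimodule`: if `P` is a progenerator over a
  commutative ring `C`, and `A` acts faithfully on `P` by `C`-linear maps which include the rank one
  operators of a dual basis, then `P ⊗[C] -` is an equivalence from `C`-modules to `A`-modules.
* Fourier analysis: rapidly decreasing double sequences are exactly the Fourier coefficients of
  smooth doubly periodic functions (`fourierCoef_fourierSum`, `fourierSum_fourierCoef`), and these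
  functions are the smooth functions on the torus (`torusEquiv`). Collecting the powers of `V`
  according to their residue modulo `N` shows that the noncommutative torus acts by all the sums of
  the `N` shifts `f(s, t) ↦ f(s - jb/N, t)`, weighted by smooth functions with the appropriate
  factor of automorphy (`torusAct_eq_sum`, `exists_residuePart_eq`).
* Generating sections of the line bundle and of its dual, built from bump functions
  (`exists_dual_sections`). Multiplied by the characters `exp (2πiks)`, `0 ≤ k < N`, they form a
  dual basis over the base. The pairing with a section of the dual, followed by the average over
  the fibres of the covering, is itself a weighted sum of shifts, so the rank one operators come
  from the noncommutative torus (`CoverSection.exists_torusRep_eq_transfer_smul`).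
-/

/-! ### Morita equivalence from a faithful progenerator -/

section Morita

open CategoryTheory TensorProduct
open scoped ModuleCat.Algebra

universe u

variable {A C P : Type u} [Ring A] [CommRing C] [AddCommGroup P] [Module C P] [Module A P]
  [SMulCommClass C A P]

/-- `id ⊗ f` as an `A`-linear map, where `A` acts on the left factor of `P ⊗[C] N`. -/
noncomputable def leftLinearLTensor {N N' : Type u} [AddCommGroup N] [Module C N] [AddCommGroup N']
    [Module C N'] (f : N →ₗ[C] N') : P ⊗[C] N →ₗ[A] P ⊗[C] N' :=
  { f.lTensor P with
    map_smul' := fun a z => by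
      simp only [AddHom.toFun_eq_coe, LinearMap.coe_toAddHom, RingHom.id_apply]
      induction z with
      | zero => simp
      | add x y hx hy => simp only [smul_add, map_add, hx, hy]
      | tmul x n => simp only [TensorProduct.smul_tmul', LinearMap.lTensor_tmul] }

@[simp] theorem leftLinearLTensor_tmul {N N' : Type u} [AddCommGroup N] [Module C N]
    [AddCommGroup N'] [Module C N'] (f : N →ₗ[C] N') (x : P) (n : N) :
    leftLinearLTensor (A := A) f (x ⊗ₜ[C] n) = x ⊗ₜ f n := rfl

theorem leftLinearLTensor_apply {N N' : Type u} [AddCommGroup N] [Module C N]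
    [AddCommGroup N'] [Module C N'] (f : N →ₗ[C] N') (z : P ⊗[C] N) :
    leftLinearLTensor (A := A) f z = f.lTensor P z := rfl

variable (A C P) in
/-- The functor `P ⊗[C] -` from `C`-modules to `A`-modules, for an `A`-`C`-bimodule `P`. -/
noncomputable def bimoduleTensor : ModuleCat.{u} C ⥤ ModuleCat.{u} A where
  obj N := ModuleCat.of A (P ⊗[C] N)
  map f := ModuleCat.ofHom (leftLinearLTensor f.hom)
  map_id N := by
    ext x
    simp [leftLinearLTensor_apply]
  map_comp f g := by
    ext x
    simp [leftLinearLTensor_apply, LinearMap.lTensor_comp]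

theorem smul_tensor_eq_of_forall {N : Type u} [AddCommGroup N] [Module C N] {a : A} {c : C}
    (h : ∀ x : P, a • x = c • x) (z : P ⊗[C] N) : a • z = c • z := by
  induction z with
  | zero => simp
  | add x y hx hy => rw [smul_add, smul_add, hx, hy]
  | tmul x n => rw [TensorProduct.smul_tmul', TensorProduct.smul_tmul', h]

/-- `φ ⊗ id : P ⊗[C] N → C ⊗[C] N = N`. -/
noncomputable def contractTensor (φ : P →ₗ[C] C) (N : Type u) [AddCommGroup N] [Module C N] :
    P ⊗[C] N →ₗ[C] N :=
  (TensorProduct.lid C N).toLinearMap ∘ₗ φ.rTensor N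

@[simp] theorem contractTensor_tmul (φ : P →ₗ[C] C) {N : Type u} [AddCommGroup N] [Module C N]
    (x : P) (n : N) : contractTensor φ N (x ⊗ₜ n) = φ x • n := by
  simp [contractTensor]

/-- An element of `A` that acts on `P` as the rank one operator `y ↦ φ y • x` acts on `P ⊗[C] N` as
`z ↦ x ⊗ (φ ⊗ id) z`. -/
theorem rankOne_smul {a : A} {x : P} {φ : P →ₗ[C] C} (h : ∀ y, a • y = φ y • x)
    {N : Type u} [AddCommGroup N] [Module C N] (z : P ⊗[C] N) :
    a • z = x ⊗ₜ contractTensor φ N z := by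
  induction z with
  | zero => simp
  | add z w hz hw => rw [smul_add, hz, hw, map_add, TensorProduct.tmul_add]
  | tmul y n =>
    rw [TensorProduct.smul_tmul', h, contractTensor_tmul, TensorProduct.smul_tmul]

/-- The `C`-module structure on `A`-linear maps out of an `A`-`C`-bimodule, by precomposition. -/
@[reducible] def precompModule (M : Type u) [AddCommGroup M] [Module A M] :
    Module C (P →ₗ[A] M) where
  smul c h :=
    { toFun := fun x => h (c • x)
      map_add' := fun x y => by rw [smul_add, map_add]
      map_smul' := fun a x => by rw [smul_comm c a x, map_smul, RingHom.id_apply] }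
  one_smul h := LinearMap.ext fun x => congrArg h (one_smul C x)
  mul_smul c d h := LinearMap.ext fun x => congrArg h ((mul_comm c d ▸ mul_smul d c x))
  smul_zero c := rfl
  smul_add c h k := rfl
  add_smul c d h := LinearMap.ext fun x =>
    (congrArg h (add_smul c d x)).trans (map_add h _ _)
  zero_smul h := LinearMap.ext fun x => (congrArg h (zero_smul C x)).trans (map_zero h)

attribute [local instance] precompModule

/-- The evaluation map `P ⊗[C] Hom_A(P, M) → M`. -/
noncomputable def evalTensor (M : Type u) [AddCommGroup M] [Module A M] :
    P ⊗[C] (P →ₗ[A] M) →+ M :=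
  TensorProduct.liftAddHom
    { toFun := fun x =>
        { toFun := fun h => h x
          map_zero' := rfl
          map_add' := fun _ _ => rfl }
      map_zero' := by ext h; exact map_zero h
      map_add' := fun x y => by ext h; exact map_add h x y }
    (fun c x h => rfl)

@[simp] theorem evalTensor_tmul {M : Type u} [AddCommGroup M] [Module A M] (x : P)
    (h : P →ₗ[A] M) : evalTensor M (x ⊗ₜ[C] h) = h x := rfl

theorem evalTensor_smul {M : Type u} [AddCommGroup M] [Module A M] (a : A)
    (z : P ⊗[C] (P →ₗ[A] M)) : evalTensor M (a • z) = a • evalTensor M z := by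
  induction z with
  | zero => simp
  | add z w hz hw => rw [smul_add, map_add, hz, hw, map_add, smul_add]
  | tmul x h => rw [TensorProduct.smul_tmul', evalTensor_tmul, evalTensor_tmul, map_smul]

variable {ι : Type*} [Fintype ι] {φ : ι → P →ₗ[C] C} {p r : ι → P} {θ : ι → P → A}

/-- Evaluation `P ⊗[C] Hom_A(P, M) → M` is bijective; with a dual basis `(p, φ)` of `P` over `C`,
its inverse is `m ↦ ∑ i, p i ⊗ (x ↦ θ i x • m)`, where `θ i x` acts on `P` as `φ i (-) • x`. -/
theorem evalTensor_bijective [FaithfulSMul A P] (hp : ∀ x, ∑ i, φ i x • p i = x)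
    (hθ : ∀ i x y, θ i x • y = φ i y • x) (M : Type u) [AddCommGroup M] [Module A M] :
    Function.Bijective (evalTensor (A := A) (C := C) (P := P) M) := by
  have hext {a b : A} (h : ∀ x : P, a • x = b • x) : a = b := eq_of_smul_eq_smul h
  let g (i : ι) (m : M) : P →ₗ[A] M :=
    { toFun := fun x => θ i x • m
      map_add' := fun x y => by
        rw [← add_smul]
        congr 1
        exact hext fun z => by rw [add_smul, hθ, hθ, hθ, smul_add]
      map_smul' := fun a x => by
        rw [RingHom.id_apply, ← mul_smul]
        congr 1
        exact hext fun z => by rw [mul_smul, hθ, hθ, smul_comm] }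
  let G : M →+ P ⊗[C] (P →ₗ[A] M) :=
    { toFun := fun m => ∑ i, p i ⊗ₜ g i m
      map_zero' := Finset.sum_eq_zero fun i _ => by
        rw [show g i 0 = 0 from LinearMap.ext fun x => smul_zero _, TensorProduct.tmul_zero]
      map_add' := fun m m' => by
        rw [← Finset.sum_add_distrib]
        refine Finset.sum_congr rfl fun i _ => ?_
        rw [← TensorProduct.tmul_add]
        congr 1
        exact LinearMap.ext fun x => smul_add _ _ _ }
  have h1 : ∀ m, evalTensor M (G m) = m := fun m => by
    change evalTensor M (∑ i, p i ⊗ₜ g i m) = m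
    rw [map_sum]
    change ∑ i, θ i (p i) • m = m
    rw [← Finset.sum_smul]
    have : ∑ i, θ i (p i) = (1 : A) := hext fun x => by
      rw [Finset.sum_smul, one_smul]
      simp only [hθ, hp]
    rw [this, one_smul]
  have h2 : ∀ z, G (evalTensor M z) = z := fun z => by
    induction z with
    | zero => simp
    | add z w hz hw => rw [map_add, map_add, hz, hw]
    | tmul x h =>
      change ∑ i, p i ⊗ₜ g i (h x) = x ⊗ₜ h
      conv_rhs => rw [← hp x, TensorProduct.sum_tmul]
      refine Finset.sum_congr rfl fun i _ => ?_
      rw [TensorProduct.smul_tmul]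
      congr 1
      ext y
      change θ i y • h x = h (φ i x • y)
      rw [← map_smul, hθ]
  exact ⟨Function.LeftInverse.injective h2, Function.RightInverse.surjective h1⟩

/-- An `A`-`C`-bimodule `P` on which `A` acts faithfully gives a Morita equivalence, provided that
`P` is finitely generated projective over `C` (there is a dual basis `(p, φ)`), that it is a
generator (`∑ i, φ i (r i) = 1`), and that the rank one operators `φ i (-) • x` come from `A`. -/
theorem IsMoritaEquivalent.of_bimodule (R : Type*) [CommRing R] [Algebra R A] [Algebra R C]
    [FaithfulSMul A P] (hR : ∀ (c : R) (x : P), algebraMap R A c • x = algebraMap R C c • x)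
    (hp : ∀ x, ∑ i, φ i x • p i = x) (hr : ∑ i, φ i (r i) = 1)
    (hφ : ∀ i x, ∃ a : A, ∀ y, a • y = φ i y • x) :
    IsMoritaEquivalent R A C := by
  choose θ hθ using hφ
  -- for fullness and faithfulness, `n` is recovered from the elements `r i ⊗ n` of `P ⊗ N`
  have hcontract {N : Type u} [AddCommGroup N] [Module C N] (n : N) :
      ∑ i, contractTensor (φ i) N (r i ⊗ₜ n) = n := by
    simp only [contractTensor_tmul, ← Finset.sum_smul, hr, one_smul]
  -- the action of `C` on `P` comes from elements of `A`, so `A`-linear maps between modules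
  -- `P ⊗ N` are `C`-linear
  have hC (c : C) : ∃ a : A, ∀ x : P, a • x = c • x :=
    ⟨∑ i, θ i (c • p i), fun x => by
      rw [Finset.sum_smul]
      simp only [hθ, smul_comm _ c]
      rw [← Finset.smul_sum, hp]⟩
  have faithful : (bimoduleTensor A C P).Faithful :=
    { map_injective := fun {N N'} f g hfg => by
        ext n
        have key : ∀ x : P, x ⊗ₜ[C] f.hom n = x ⊗ₜ g.hom n := fun x =>
          congrArg (fun k => k.hom (x ⊗ₜ[C] n)) hfg
        rw [← hcontract (f.hom n), ← hcontract (g.hom n)]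
        simp only [key] }
  have full : (bimoduleTensor A C P).Full :=
    { map_surjective := fun {N N'} k => by
        let h : P ⊗[C] N →ₗ[A] P ⊗[C] N' := k.hom
        let f : N →ₗ[C] N' :=
          { toFun := fun n => ∑ i, contractTensor (φ i) N' (h (r i ⊗ₜ n))
            map_add' := fun m n => by
              simp only [TensorProduct.tmul_add, map_add, Finset.sum_add_distrib]
            map_smul' := fun c n => by
              obtain ⟨a, ha⟩ := hC c
              rw [RingHom.id_apply, Finset.smul_sum]
              refine Finset.sum_congr rfl fun i _ => ?_
              rw [TensorProduct.tmul_smul, ← smul_tensor_eq_of_forall ha, map_smul,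
                smul_tensor_eq_of_forall ha, map_smul] }
        suffices H : ∀ z, leftLinearLTensor (A := A) f z = h z from
          ⟨ModuleCat.ofHom f, ModuleCat.hom_ext (LinearMap.ext H)⟩
        intro z
        induction z with
        | zero => simp
        | add z w hz hw => rw [map_add, map_add, hz, hw]
        | tmul x n =>
          rw [leftLinearLTensor_tmul]
          change x ⊗ₜ (∑ i, contractTensor (φ i) N' (h (r i ⊗ₜ n))) = _
          rw [TensorProduct.tmul_sum]
          simp only [← rankOne_smul (hθ _ x), ← map_smul]
          rw [← map_sum]
          simp only [TensorProduct.smul_tmul', hθ]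
          rw [← TensorProduct.sum_tmul, ← Finset.sum_smul, hr, one_smul] }
  have essSurj : (bimoduleTensor A C P).EssSurj :=
    { mem_essImage := fun M =>
        ⟨ModuleCat.of C (P →ₗ[A] M), ⟨LinearEquiv.toModuleIso
          (LinearEquiv.ofBijective
            { evalTensor (A := A) (C := C) (P := P) M with map_smul' := evalTensor_smul }
            (evalTensor_bijective hp hθ M))⟩⟩ }
  have : (bimoduleTensor A C P).IsEquivalence := { }
  refine IsMoritaEquivalent.symm R ⟨⟨⟨(bimoduleTensor A C P).asEquivalence, ?_⟩⟩⟩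
  have linear {N N' : ModuleCat.{u} C} (f : N ⟶ N') (c : R) (z : P ⊗[C] N) :
      leftLinearLTensor (A := A) (algebraMap R C c • f.hom) z =
        algebraMap R A c • leftLinearLTensor (A := A) f.hom z := by
    rw [smul_tensor_eq_of_forall (hR c), leftLinearLTensor_apply, leftLinearLTensor_apply,
      LinearMap.lTensor_smul, LinearMap.smul_apply]
  exact { map_smul := fun f c => ModuleCat.hom_ext (LinearMap.ext (linear f c)) }

end Morita

noncomputable section

namespace NCT

open MeasureTheory

/-! ### The exponential `x ↦ exp (2πix)` -/

/-- The complex number `exp (2πix)`. -/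
def unitExp (x : ℝ) : ℂ := Complex.exp (2 * Real.pi * Complex.I * x)

theorem unitExp_add (x y : ℝ) : unitExp (x + y) = unitExp x * unitExp y := by
  simp only [unitExp, ← Complex.exp_add]
  push_cast
  ring_nf

@[simp] theorem unitExp_zero : unitExp 0 = 1 := by simp [unitExp]

theorem unitExp_intCast (n : ℤ) : unitExp n = 1 := by
  rw [unitExp, Complex.exp_eq_one_iff]
  exact ⟨n, by push_cast; ring⟩

theorem unitExp_add_intCast (x : ℝ) (n : ℤ) : unitExp (x + n) = unitExp x := by
  rw [unitExp_add, unitExp_intCast, mul_one]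

theorem unitExp_mul_neg (x : ℝ) : unitExp x * unitExp (-x) = 1 := by
  rw [← unitExp_add, add_neg_cancel, unitExp_zero]

@[simp] theorem norm_unitExp (x : ℝ) : ‖unitExp x‖ = 1 := by
  rw [unitExp, show 2 * (Real.pi : ℂ) * Complex.I * x = ((2 * Real.pi * x : ℝ) : ℂ) * Complex.I by
    push_cast; ring]
  exact Complex.norm_exp_ofReal_mul_I _

theorem unitExp_eq_one_iff (x : ℝ) : unitExp x = 1 ↔ ∃ n : ℤ, x = n := by
  constructor
  · rw [unitExp, Complex.exp_eq_one_iff]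
    rintro ⟨n, hn⟩
    refine ⟨n, ?_⟩
    have : (2 * Real.pi * Complex.I : ℂ) * ((x : ℂ) - n) = 0 := by linear_combination hn
    rcases mul_eq_zero.1 this with h | h
    · exact absurd h Complex.two_pi_I_ne_zero
    · exact_mod_cast sub_eq_zero.1 h
  · rintro ⟨n, rfl⟩
    exact unitExp_intCast n

theorem unitExp_zpow (x : ℝ) (n : ℤ) : unitExp x ^ n = unitExp (n * x) := by
  rw [unitExp, unitExp, ← Complex.exp_int_mul]
  push_cast
  ring_nf

@[fun_prop] theorem contDiff_unitExp {n : WithTop ℕ∞} : ContDiff ℝ n unitExp := by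
  unfold unitExp
  have : ContDiff ℝ n fun x : ℝ => (x : ℂ) := Complex.ofRealCLM.contDiff
  fun_prop

@[fun_prop] theorem continuous_unitExp : Continuous unitExp :=
  (contDiff_unitExp (n := 0)).continuous

theorem hasDerivAt_unitExp (x : ℝ) :
    HasDerivAt unitExp (2 * Real.pi * Complex.I * unitExp x) x := by
  have h : HasDerivAt (fun x : ℝ => 2 * Real.pi * Complex.I * (x : ℂ))
      (2 * Real.pi * Complex.I) x := by
    simpa using (Complex.ofRealCLM.hasDerivAt (x := x)).const_mul (2 * Real.pi * Complex.I)
  rw [mul_comm]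
  exact h.cexp

theorem integral_unitExp (n : ℤ) : ∫ s in (0 : ℝ)..1, unitExp (n * s) = if n = 0 then 1 else 0 := by
  split_ifs with h
  · simp [h]
  · have hn : (2 * Real.pi * Complex.I * n : ℂ) ≠ 0 :=
      mul_ne_zero Complex.two_pi_I_ne_zero (by exact_mod_cast h)
    have hd (s : ℝ) : HasDerivAt
        (fun s : ℝ => (2 * Real.pi * Complex.I * n : ℂ)⁻¹ * unitExp (n * s))
        (unitExp (n * s)) s := by
      have h1 := (hasDerivAt_unitExp (n * s)).scomp s ((hasDerivAt_id s).const_mul (n : ℝ))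
      refine (h1.const_mul ((2 * Real.pi * Complex.I * n : ℂ)⁻¹)).congr_deriv ?_
      rw [Complex.real_smul]
      push_cast
      field_simp
    rw [intervalIntegral.integral_eq_sub_of_hasDerivAt (fun s _ => hd s)
      (Continuous.intervalIntegrable (by fun_prop) _ _)]
    have : unitExp (n * (1 : ℝ)) = 1 := by rw [mul_one, unitExp_intCast]
    rw [this]
    simp

/-! ### Smooth doubly periodic functions and their Fourier series -/

/-- The algebra of smooth functions on the plane that are periodic under `ℤ × ℤ`. -/
def periodicSmooth : Subalgebra ℂ (ℝ × ℝ → ℂ) where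
  carrier := {f | ContDiff ℝ ∞ f ∧ (∀ s t, f (s + 1, t) = f (s, t)) ∧
    ∀ s t, f (s, t + 1) = f (s, t)}
  mul_mem' hf hg := ⟨hf.1.mul hg.1, fun s t => by simp [hf.2.1, hg.2.1],
    fun s t => by simp [hf.2.2, hg.2.2]⟩
  add_mem' hf hg := ⟨hf.1.add hg.1, fun s t => by simp [hf.2.1, hg.2.1],
    fun s t => by simp [hf.2.2, hg.2.2]⟩
  algebraMap_mem' c := ⟨contDiff_const, fun _ _ => rfl, fun _ _ => rfl⟩

theorem mem_periodicSmooth {f : ℝ × ℝ → ℂ} : f ∈ periodicSmooth ↔ ContDiff ℝ ∞ f ∧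
    (∀ s t, f (s + 1, t) = f (s, t)) ∧ ∀ s t, f (s, t + 1) = f (s, t) := Iff.rfl

/-- The sum of the Fourier series with coefficients `a`. -/
def fourierSum (a : ℤ × ℤ → ℂ) (p : ℝ × ℝ) : ℂ :=
  ∑' x : ℤ × ℤ, a x * unitExp (x.1 * p.1 + x.2 * p.2)

theorem summable_fourierSum {a : ℤ × ℤ → ℂ} (ha : IsRapid a) (p : ℝ × ℝ) :
    Summable fun x : ℤ × ℤ => a x * unitExp (x.1 * p.1 + x.2 * p.2) :=
  Summable.of_norm (by simpa using summable_norm ha)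

theorem IsRapid.of_norm_le {a b : ℤ × ℤ → ℂ} (ha : IsRapid a) (C : ℝ)
    (h : ∀ x, ‖b x‖ ≤ C * (‖a x‖ * weight x)) : IsRapid b := by
  refine isRapid_iff.2 fun m => ?_
  obtain ⟨D, hD⟩ := isRapid_iff.1 ha (m + 1)
  have hC : ∀ x, ‖b x‖ ≤ |C| * (‖a x‖ * weight x) := fun x => (h x).trans
    (mul_le_mul_of_nonneg_right (le_abs_self C) (mul_nonneg (norm_nonneg _) (weight_pos x).le))
  refine ⟨|C| * D, fun x => ?_⟩
  calc ‖b x‖ * weight x ^ m ≤ |C| * (‖a x‖ * weight x) * weight x ^ m :=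
        mul_le_mul_of_nonneg_right (hC x) (pow_pos (weight_pos x) m).le
    _ = |C| * (‖a x‖ * weight x ^ (m + 1)) := by ring
    _ ≤ |C| * D := mul_le_mul_of_nonneg_left (hD x) (abs_nonneg C)

theorem abs_fst_le_weight (x : ℤ × ℤ) : |(x.1 : ℝ)| ≤ weight x := by
  unfold weight; linarith [abs_nonneg (x.2 : ℝ)]

theorem abs_snd_le_weight (x : ℤ × ℤ) : |(x.2 : ℝ)| ≤ weight x := by
  unfold weight; linarith [abs_nonneg (x.1 : ℝ)]

theorem IsRapid.fst_mul {a : ℤ × ℤ → ℂ} (ha : IsRapid a) (c : ℂ) :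
    IsRapid fun x => c * x.1 * a x :=
  ha.of_norm_le ‖c‖ fun x => by
    rw [norm_mul, norm_mul, Complex.norm_intCast, mul_assoc, mul_comm |(x.1 : ℝ)|]
    gcongr
    exact abs_fst_le_weight x

theorem IsRapid.snd_mul {a : ℤ × ℤ → ℂ} (ha : IsRapid a) (c : ℂ) :
    IsRapid fun x => c * x.2 * a x :=
  ha.of_norm_le ‖c‖ fun x => by
    rw [norm_mul, norm_mul, Complex.norm_intCast, mul_assoc, mul_comm |(x.2 : ℝ)|]
    gcongr
    exact abs_snd_le_weight x

/-- The partial derivatives of a Fourier series with rapidly decreasing coefficients are again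
of this form. -/
theorem hasFDerivAt_fourierSum {a : ℤ × ℤ → ℂ} (ha : IsRapid a) (p : ℝ × ℝ) :
    HasFDerivAt (fourierSum a)
      (fourierSum (fun x => 2 * Real.pi * Complex.I * x.1 * a x) p •
          (Complex.ofRealCLM.comp (ContinuousLinearMap.fst ℝ ℝ ℝ)) +
        fourierSum (fun x => 2 * Real.pi * Complex.I * x.2 * a x) p •
          (Complex.ofRealCLM.comp (ContinuousLinearMap.snd ℝ ℝ ℝ))) p := by
  have h1 := ha.fst_mul (2 * Real.pi * Complex.I)
  have h2 := ha.snd_mul (2 * Real.pi * Complex.I)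
  have hL1 : ‖Complex.ofRealCLM.comp (ContinuousLinearMap.fst ℝ ℝ ℝ)‖ ≤ 1 :=
    ContinuousLinearMap.opNorm_le_bound _ zero_le_one fun v => by
      simpa using norm_fst_le v
  have hL2 : ‖Complex.ofRealCLM.comp (ContinuousLinearMap.snd ℝ ℝ ℝ)‖ ≤ 1 :=
    ContinuousLinearMap.opNorm_le_bound _ zero_le_one fun v => by
      simpa using norm_snd_le v
  have hterm (x : ℤ × ℤ) (p : ℝ × ℝ) :
      HasFDerivAt (fun p : ℝ × ℝ => a x * unitExp (x.1 * p.1 + x.2 * p.2))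
        ((2 * Real.pi * Complex.I * x.1 * a x * unitExp (x.1 * p.1 + x.2 * p.2)) •
            (Complex.ofRealCLM.comp (ContinuousLinearMap.fst ℝ ℝ ℝ)) +
          (2 * Real.pi * Complex.I * x.2 * a x * unitExp (x.1 * p.1 + x.2 * p.2)) •
            (Complex.ofRealCLM.comp (ContinuousLinearMap.snd ℝ ℝ ℝ))) p := by
    have hl : HasFDerivAt (fun p : ℝ × ℝ => (x.1 : ℝ) * p.1 + x.2 * p.2)
        ((x.1 : ℝ) • ContinuousLinearMap.fst ℝ ℝ ℝ + (x.2 : ℝ) • ContinuousLinearMap.snd ℝ ℝ ℝ) p :=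
      (hasFDerivAt_fst.const_mul _).add (hasFDerivAt_snd.const_mul _)
    refine ((((hasDerivAt_unitExp _).hasFDerivAt.comp p hl).const_mul (a x))).congr_fderiv ?_
    ext <;> simp <;> ring
  have hsum := hasFDerivAt_tsum (x₀ := 0) ((summable_norm h1).add (summable_norm h2)) hterm
    (fun x p => ?_) (summable_fourierSum ha 0) p
  · have e1 := summable_fourierSum h1 p
    have e2 := summable_fourierSum h2 p
    rw [(e1.smul_const _).tsum_add (e2.smul_const _), e1.tsum_smul_const,
      e2.tsum_smul_const] at hsum
    exact hsum
  · refine (norm_add_le _ _).trans (add_le_add ?_ ?_)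
    · rw [norm_smul, norm_mul _ (unitExp _), norm_unitExp, mul_one]
      exact mul_le_of_le_one_right (norm_nonneg _) hL1
    · rw [norm_smul, norm_mul _ (unitExp _), norm_unitExp, mul_one]
      exact mul_le_of_le_one_right (norm_nonneg _) hL2

theorem contDiff_fourierSum {a : ℤ × ℤ → ℂ} (ha : IsRapid a) : ContDiff ℝ ∞ (fourierSum a) := by
  refine contDiff_infty.2 fun n => ?_
  induction n generalizing a with
  | zero =>
    exact contDiff_zero.2 (continuous_iff_continuousAt.2 fun p =>
      (hasFDerivAt_fourierSum ha p).continuousAt)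
  | succ n ih =>
    exact contDiff_succ_iff_hasFDerivAt.2 ⟨_, ((ih (ha.fst_mul _)).smul contDiff_const).add
      ((ih (ha.snd_mul _)).smul contDiff_const), hasFDerivAt_fourierSum ha⟩

theorem fourierSum_mem {a : ℤ × ℤ → ℂ} (ha : IsRapid a) : fourierSum a ∈ periodicSmooth := by
  refine ⟨contDiff_fourierSum ha, fun s t => tsum_congr fun x => ?_, fun s t =>
    tsum_congr fun x => ?_⟩
  · rw [← unitExp_add_intCast (x.1 * s + x.2 * t) x.1]
    ring_nf
  · rw [← unitExp_add_intCast (x.1 * s + x.2 * t) x.2]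
    ring_nf

/-- The Fourier coefficients of a doubly periodic function. -/
def fourierCoef (f : ℝ × ℝ → ℂ) (x : ℤ × ℤ) : ℂ :=
  ∫ t in (0 : ℝ)..1, ∫ s in (0 : ℝ)..1, f (s, t) * unitExp (-(x.1 * s + x.2 * t))

theorem hasSum_integral_of_norm_le {ι : Type*} [Countable ι] {F : ι → ℝ → ℂ} {u : ι → ℝ}
    (hu : Summable u) (hF : ∀ i, Continuous (F i)) (hb : ∀ i s, ‖F i s‖ ≤ u i) :
    ∫ s in (0 : ℝ)..1, ∑' i, F i s = ∑' i, ∫ s in (0 : ℝ)..1, F i s := by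
  refine (intervalIntegral.hasSum_integral_of_dominated_convergence (fun i _ => u i)
    (fun i => (hF i).aestronglyMeasurable) (fun i => ae_of_all _ fun s _ => hb i s)
    (ae_of_all _ fun _ _ => hu) intervalIntegrable_const
    (ae_of_all _ fun s _ => ?_)).tsum_eq.symm
  exact (hu.of_norm_bounded (fun i => hb i s)).hasSum

theorem fourierCoef_fourierSum {a : ℤ × ℤ → ℂ} (ha : IsRapid a) :
    fourierCoef (fourierSum a) = a := by
  funext x
  have h1 (s t : ℝ) : fourierSum a (s, t) * unitExp (-(x.1 * s + x.2 * t)) =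
      ∑' y : ℤ × ℤ, a y * unitExp ((y.2 - x.2 : ℤ) * t) * unitExp ((y.1 - x.1 : ℤ) * s) := by
    rw [fourierSum, ← tsum_mul_right]
    refine tsum_congr fun y => ?_
    rw [mul_assoc, ← unitExp_add, mul_assoc, ← unitExp_add]
    push_cast
    ring_nf
  simp only [fourierCoef, h1]
  have h2 (t : ℝ) := hasSum_integral_of_norm_le (summable_norm ha)
    (F := fun y s => a y * unitExp ((y.2 - x.2 : ℤ) * t) * unitExp ((y.1 - x.1 : ℤ) * s))
    (fun y => by fun_prop) (fun y s => by simp)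
  simp only [h2, intervalIntegral.integral_const_mul, integral_unitExp]
  rw [hasSum_integral_of_norm_le (summable_norm ha) (fun y => by fun_prop)
    (fun y t => by split_ifs <;> simp)]
  simp only [intervalIntegral.integral_mul_const, intervalIntegral.integral_const_mul,
    integral_unitExp]
  rw [tsum_eq_single x]
  · simp
  · intro y hy
    by_cases h : y.1 = x.1
    · have : y.2 - x.2 ≠ 0 := fun h' => hy (Prod.ext h (sub_eq_zero.1 h'))
      simp [this]
    · simp [sub_ne_zero.2 h]

/-- A continuous periodic function whose Fourier coefficients vanish is zero: its Fourier series is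
summable, so it converges to the function. -/
theorem eq_zero_of_integral_unitExp {g : ℝ → ℂ} (hg : Continuous g) (hp : Function.Periodic g 1)
    (h : ∀ k : ℤ, ∫ s in (0 : ℝ)..1, g s * unitExp (-(k * s)) = 0) (s : ℝ) : g s = 0 := by
  let G : C(AddCircle (1 : ℝ), ℂ) := ⟨hp.lift, continuous_coinduced_dom.2 hg⟩
  have hG : fourierCoeff G = 0 := by
    funext k
    rw [fourierCoeff_eq_intervalIntegral _ _ 0, Pi.zero_apply, zero_add]
    convert smul_zero _
    rw [← h k]
    refine intervalIntegral.integral_congr fun s _ => ?_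
    simp only [smul_eq_mul]
    rw [mul_comm, fourier_coe_apply, unitExp]
    congr 2
    push_cast
    ring
  have := has_pointwise_sum_fourier_series_of_summable (f := G) (by rw [hG]; exact summable_zero) s
  simp only [hG, Pi.zero_apply, zero_smul] at this
  exact this.unique hasSum_zero

theorem eq_zero_of_fourierCoef_eq_zero {f : ℝ × ℝ → ℂ} (hf : f ∈ periodicSmooth)
    (h : fourierCoef f = 0) : f = 0 := by
  have hc : Continuous f := hf.1.continuous
  have h1 (k : ℤ) (t : ℝ) : ∫ s in (0 : ℝ)..1, f (s, t) * unitExp (-(k * s)) = 0 := by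
    refine eq_zero_of_integral_unitExp
      (g := fun t => ∫ s in (0 : ℝ)..1, f (s, t) * unitExp (-(k * s)))
      ?_ (fun t => ?_) (fun l => ?_) t
    · exact intervalIntegral.continuous_parametric_intervalIntegral_of_continuous' (by fun_prop) _ _
    · simp only [hf.2.2]
    · have := congrFun h (k, l)
      rw [fourierCoef] at this
      rw [← Pi.zero_apply (k, l) (M := fun _ => ℂ), ← this]
      refine intervalIntegral.integral_congr fun t _ => ?_
      rw [← intervalIntegral.integral_mul_const]
      refine intervalIntegral.integral_congr fun s _ => ?_
      rw [mul_assoc, ← unitExp_add, neg_add]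
  funext ⟨s, t⟩
  exact eq_zero_of_integral_unitExp (g := fun s => f (s, t)) (by fun_prop)
    (fun s => hf.2.1 s t) (fun k => h1 k t) s

theorem norm_fourierCoef_le {f : ℝ × ℝ → ℂ} (hf : f ∈ periodicSmooth) :
    ∃ C : ℝ, ∀ x, ‖fourierCoef f x‖ ≤ C := by
  obtain ⟨C, hC⟩ := ((isCompact_Icc (a := (0 : ℝ)) (b := 1)).prod
    (isCompact_Icc (a := (0 : ℝ)) (b := 1))).exists_bound_of_continuousOn
    hf.1.continuous.continuousOn
  have hsub {s : ℝ} (hs : s ∈ Set.uIoc (0 : ℝ) 1) : s ∈ Set.Icc (0 : ℝ) 1 := by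
    rw [Set.uIoc_of_le zero_le_one] at hs
    exact Set.Ioc_subset_Icc_self hs
  refine ⟨C, fun x => ?_⟩
  have := intervalIntegral.norm_integral_le_of_norm_le_const (a := 0) (b := 1) (C := C)
    (f := fun t => ∫ s in (0 : ℝ)..1, f (s, t) * unitExp (-(x.1 * s + x.2 * t))) fun t ht => ?_
  · simpa [fourierCoef] using this
  · have := intervalIntegral.norm_integral_le_of_norm_le_const (a := 0) (b := 1) (C := C)
      (f := fun s => f (s, t) * unitExp (-(x.1 * s + x.2 * t))) fun s hs => ?_
    · simpa using this
    · rw [norm_mul, norm_unitExp, mul_one]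
      exact hC (s, t) ⟨hsub hs, hsub ht⟩

/-- Integration by parts: multiplying the Fourier coefficients by the first index corresponds to
a partial derivative. -/
theorem exists_fourierCoef_fst {f : ℝ × ℝ → ℂ} (hf : f ∈ periodicSmooth) :
    ∃ g ∈ periodicSmooth, ∀ x, fourierCoef g x = x.1 * fourierCoef f x := by
  have hdiff : Differentiable ℝ f := hf.1.differentiable (by simp)
  have hper {v : ℝ × ℝ} (hv : ∀ p, f (p + v) = f p) (p : ℝ × ℝ) :
      fderiv ℝ f (p + v) = fderiv ℝ f p := by
    rw [← fderiv_comp_add_right]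
    simp only [hv]
  have hadd1 (p : ℝ × ℝ) : f (p + (1, 0)) = f p := by
    rw [show p + (1, 0) = (p.1 + 1, p.2) from Prod.ext rfl (add_zero _), hf.2.1]
  have hadd2 (p : ℝ × ℝ) : f (p + (0, 1)) = f p := by
    rw [show p + (0, 1) = (p.1, p.2 + 1) from Prod.ext (add_zero _) rfl, hf.2.2]
  let g : ℝ × ℝ → ℂ := fun p => (2 * Real.pi * Complex.I)⁻¹ * fderiv ℝ f p (1, 0)
  have hgd : ContDiff ℝ ∞ g :=
    contDiff_const.mul ((hf.1.fderiv_right (m := ∞) (by simp)).clm_apply contDiff_const)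
  have hg : g ∈ periodicSmooth := by
    refine ⟨hgd, fun s t => ?_, fun s t => ?_⟩
    · have := hper (v := (1, 0)) hadd1 (s, t)
      rw [Prod.mk_add_mk, add_zero] at this
      simp only [g, this]
    · have := hper (v := (0, 1)) hadd2 (s, t)
      rw [Prod.mk_add_mk, add_zero] at this
      simp only [g, this]
  refine ⟨g, hg, fun x => ?_⟩
  rw [fourierCoef, fourierCoef, ← intervalIntegral.integral_const_mul]
  refine intervalIntegral.integral_congr fun t _ => ?_
  have hd (s : ℝ) : HasDerivAt (fun s => (2 * Real.pi * Complex.I)⁻¹ *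
        (f (s, t) * unitExp (-(x.1 * s + x.2 * t))))
      (g (s, t) * unitExp (-(x.1 * s + x.2 * t)) -
        x.1 * (f (s, t) * unitExp (-(x.1 * s + x.2 * t)))) s := by
    have h1 : HasDerivAt (fun s : ℝ => (s, t)) ((1 : ℝ), (0 : ℝ)) s :=
      (hasDerivAt_id s).prodMk (hasDerivAt_const s t)
    have h2 : HasDerivAt (fun s => f (s, t)) (fderiv ℝ f (s, t) (1, 0)) s :=
      (hdiff (s, t)).hasFDerivAt.comp_hasDerivAt s h1
    have h3 : HasDerivAt (fun s : ℝ => -(x.1 * s + x.2 * t)) (-(x.1 : ℝ)) s := by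
      refine HasDerivAt.congr_deriv
        (((hasDerivAt_id s).const_mul (x.1 : ℝ)).add_const (x.2 * t)).neg ?_
      rw [mul_one]
    have h4 := (hasDerivAt_unitExp (-(x.1 * s + x.2 * t))).scomp s h3
    refine ((h2.mul h4).const_mul ((2 * Real.pi * Complex.I)⁻¹)).congr_deriv ?_
    simp only [g, Complex.real_smul, Function.comp]
    have := Complex.two_pi_I_ne_zero
    push_cast
    field_simp
    ring
  have hfc : Continuous f := hf.1.continuous
  have hgc : Continuous g := hgd.continuous
  have hint := intervalIntegral.integral_eq_sub_of_hasDerivAt (a := 0) (b := 1) (fun s _ => hd s)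
    (Continuous.intervalIntegrable (by fun_prop) _ _)
  rw [intervalIntegral.integral_sub (Continuous.intervalIntegrable (by fun_prop) _ _)
    (Continuous.intervalIntegrable (by fun_prop) _ _),
    intervalIntegral.integral_const_mul] at hint
  rw [← sub_eq_zero, hint, sub_eq_zero]
  have e1 : f (1, t) = f (0, t) := by simpa using hf.2.1 0 t
  have e2 : unitExp (-(x.1 * 1 + x.2 * t)) = unitExp (-(x.1 * 0 + x.2 * t)) := by
    rw [← unitExp_add_intCast _ x.1]
    ring_nf
  rw [e1, e2]

theorem swap_mem_periodicSmooth {f : ℝ × ℝ → ℂ} (hf : f ∈ periodicSmooth) :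
    f ∘ Prod.swap ∈ periodicSmooth :=
  ⟨hf.1.comp (contDiff_snd.prodMk contDiff_fst), fun s t => hf.2.2 t s, fun s t => hf.2.1 t s⟩

theorem fourierCoef_swap {f : ℝ × ℝ → ℂ} (hf : f ∈ periodicSmooth) (x : ℤ × ℤ) :
    fourierCoef (f ∘ Prod.swap) x = fourierCoef f x.swap := by
  have hc : Continuous f := hf.1.continuous
  rw [fourierCoef, fourierCoef, intervalIntegral_intervalIntegral_swap]
  · refine intervalIntegral.integral_congr fun s _ => intervalIntegral.integral_congr fun t _ => ?_
    simp [add_comm]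
  · have hcont : Continuous (Function.uncurry fun t s : ℝ =>
        (f ∘ Prod.swap) (s, t) * unitExp (-(x.1 * s + x.2 * t))) := by
      simp only [Function.uncurry_def, Function.comp, Prod.swap]
      fun_prop
    exact (hcont.continuousOn.integrableOn_compact
      (isCompact_uIcc.prod isCompact_uIcc)).mono_set
      (Set.prod_mono Set.uIoc_subset_uIcc Set.uIoc_subset_uIcc)

theorem exists_fourierCoef_snd {f : ℝ × ℝ → ℂ} (hf : f ∈ periodicSmooth) :
    ∃ g ∈ periodicSmooth, ∀ x, fourierCoef g x = x.2 * fourierCoef f x := by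
  obtain ⟨g, hg, h⟩ := exists_fourierCoef_fst (swap_mem_periodicSmooth hf)
  exact ⟨g ∘ Prod.swap, swap_mem_periodicSmooth hg, fun x => by
    rw [fourierCoef_swap hg, h, fourierCoef_swap hf, Prod.swap_swap, Prod.fst_swap]⟩

theorem isRapid_fourierCoef {f : ℝ × ℝ → ℂ} (hf : f ∈ periodicSmooth) :
    IsRapid (fourierCoef f) := by
  refine isRapid_iff.2 fun m => ?_
  induction m generalizing f with
  | zero => simpa using norm_fourierCoef_le hf
  | succ m ih =>
    -- one more factor `1 + |k| + |l|` costs one more derivative in either variable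
    obtain ⟨g, hg, hgf⟩ := exists_fourierCoef_fst hf
    obtain ⟨h, hh, hhf⟩ := exists_fourierCoef_snd hf
    obtain ⟨C, hC⟩ := ih hf
    obtain ⟨D, hD⟩ := ih hg
    obtain ⟨E, hE⟩ := ih hh
    refine ⟨C + D + E, fun x => ?_⟩
    refine le_trans (le_of_eq ?_) (add_le_add (add_le_add (hC x) (hD x)) (hE x))
    rw [hgf, hhf, norm_mul, norm_mul, Complex.norm_intCast, Complex.norm_intCast, pow_succ]
    conv_lhs => rw [weight]
    rw [weight]
    ring

/-- Every smooth doubly periodic function is the sum of its Fourier series. -/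
theorem fourierSum_fourierCoef {f : ℝ × ℝ → ℂ} (hf : f ∈ periodicSmooth) :
    fourierSum (fourierCoef f) = f := by
  have hr := isRapid_fourierCoef hf
  have hm := fourierSum_mem hr
  rw [← sub_eq_zero]
  refine eq_zero_of_fourierCoef_eq_zero (sub_mem hm hf) ?_
  have hc1 : Continuous f := hf.1.continuous
  have hc2 : Continuous (fourierSum (fourierCoef f)) := hm.1.continuous
  have hsub (x : ℤ × ℤ) : fourierCoef (fourierSum (fourierCoef f) - f) x =
      fourierCoef (fourierSum (fourierCoef f)) x - fourierCoef f x := by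
    simp only [fourierCoef, Pi.sub_apply, sub_mul]
    rw [← intervalIntegral.integral_sub]
    · refine intervalIntegral.integral_congr fun t _ => ?_
      exact intervalIntegral.integral_sub (Continuous.intervalIntegrable (by fun_prop) _ _)
        (Continuous.intervalIntegrable (by fun_prop) _ _)
    · exact (intervalIntegral.continuous_parametric_intervalIntegral_of_continuous'
        (by fun_prop) _ _).intervalIntegrable _ _
    · exact (intervalIntegral.continuous_parametric_intervalIntegral_of_continuous'
        (by fun_prop) _ _).intervalIntegrable _ _
  funext x
  rw [hsub, fourierCoef_fourierSum hr, sub_self, Pi.zero_apply]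

/-! ### Smooth functions on the torus are smooth doubly periodic functions -/

/-- The covering map of the circle, `x ↦ exp (2πix)`. -/
def circleCover (x : ℝ) : Circle := Circle.exp (2 * Real.pi * x)

theorem contMDiff_circleCover : ContMDiff 𝓘(ℝ, ℝ) (𝓡 1) ∞ circleCover :=
  contMDiff_circleExp.comp (contDiff_const.mul contDiff_id).contMDiff

theorem circleCover_eq_iff {x y : ℝ} : circleCover x = circleCover y ↔ ∃ m : ℤ, x = y + m := by
  rw [circleCover, circleCover, Circle.exp_eq_exp]
  refine exists_congr fun m => ?_
  have := Real.two_pi_pos.ne'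
  constructor <;> intro h
  · apply mul_left_cancel₀ this
    linear_combination h
  · rw [h]; ring

attribute [local instance] finrank_real_complex_fact' in
/-- Near each point of the circle the covering map has a smooth section. The branch cut of the
logarithm is moved away from the point `z₀` by a rotation. -/
theorem exists_smooth_lift (z₀ : Circle) : ∃ L : Circle → ℝ,
    ContMDiffAt (𝓡 1) 𝓘(ℝ, ℝ) ∞ L z₀ ∧ ∀ z, circleCover (L z) = z := by
  refine ⟨fun z => (2 * Real.pi)⁻¹ * ((Complex.log ((z₀⁻¹ : Circle) * (z : ℂ))).im +
    Complex.arg z₀), ?_, fun z => ?_⟩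
  · have hlog : ContDiffAt ℝ ∞ (fun w : ℂ => (2 * Real.pi)⁻¹ *
        ((Complex.log ((z₀⁻¹ : Circle) * w)).im + Complex.arg z₀)) (z₀ : ℂ) := by
      have h1 : ContDiffAt ℝ ∞ Complex.log ((z₀⁻¹ : Circle) * (z₀ : ℂ)) := by
        refine (Complex.contDiffAt_log ?_).restrict_scalars ℝ
        rw [← Circle.coe_mul, inv_mul_cancel, Circle.coe_one]
        exact Complex.one_mem_slitPlane
      have h2 := h1.comp (z₀ : ℂ)
        (contDiffAt_const.mul contDiffAt_id : ContDiffAt ℝ ∞ (fun w : ℂ => (z₀⁻¹ : Circle) * w) _)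
      exact contDiffAt_const.mul
        ((Complex.imCLM.contDiff.contDiffAt.comp (z₀ : ℂ) h2).add contDiffAt_const)
    have hcoe : ContMDiff (M := Circle) (𝓡 1) 𝓘(ℝ, ℂ) ∞ (fun z => (z : ℂ)) := contMDiff_coe_sphere
    exact hlog.contMDiffAt.comp z₀ (hcoe z₀)
  · rw [circleCover, mul_inv_cancel_left₀ Real.two_pi_pos.ne', ← Circle.coe_mul, Complex.log_im,
      Circle.exp_add, Circle.exp_arg, Circle.exp_arg, mul_comm, mul_inv_cancel_left]

/-- A function on the torus as a doubly periodic function on the plane. -/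
def torusPullback (F : SmoothTorus) (p : ℝ × ℝ) : ℂ := F (circleCover p.1, circleCover p.2)

theorem torusPullback_mem (F : SmoothTorus) : torusPullback F ∈ periodicSmooth := by
  have h (s : ℝ) : circleCover (s + 1) = circleCover s := circleCover_eq_iff.2 ⟨1, by simp⟩
  refine ⟨?_, fun s t => by simp only [torusPullback, h], fun s t => by
    simp only [torusPullback, h]⟩
  rw [← contMDiff_iff_contDiff]
  have h1 : ContMDiff 𝓘(ℝ, ℝ × ℝ) (𝓡 1) ∞ fun p : ℝ × ℝ => circleCover p.1 :=
    contMDiff_circleCover.comp contDiff_fst.contMDiff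
  have h2 : ContMDiff 𝓘(ℝ, ℝ × ℝ) (𝓡 1) ∞ fun p : ℝ × ℝ => circleCover p.2 :=
    contMDiff_circleCover.comp contDiff_snd.contMDiff
  exact F.contMDiff.comp (h1.prodMk h2)

theorem circleCover_surjective : Function.Surjective circleCover := fun z => by
  obtain ⟨L, -, hL⟩ := exists_smooth_lift z
  exact ⟨L z, hL z⟩

theorem eq_of_circleCover_eq {f : ℝ × ℝ → ℂ} (hf : f ∈ periodicSmooth) {p q : ℝ × ℝ}
    (h1 : circleCover p.1 = circleCover q.1) (h2 : circleCover p.2 = circleCover q.2) :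
    f p = f q := by
  obtain ⟨m, hm⟩ := circleCover_eq_iff.1 h1
  obtain ⟨n, hn⟩ := circleCover_eq_iff.1 h2
  have e1 (t : ℝ) : Function.Periodic (fun s => f (s, t)) 1 := fun s => hf.2.1 s t
  have e2 (s : ℝ) : Function.Periodic (fun t => f (s, t)) 1 := fun t => hf.2.2 s t
  have i1 := (e1 (q.2 + n)).int_mul m q.1
  have i2 := (e2 q.1).int_mul n q.2
  simp only [mul_one] at i1 i2
  rw [← Prod.mk.eta (p := p), hm, hn, i1, i2]

theorem exists_torusPullback_eq {f : ℝ × ℝ → ℂ} (hf : f ∈ periodicSmooth) :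
    ∃ F : SmoothTorus, torusPullback F = f := by
  choose lift hlift using circleCover_surjective
  refine ⟨⟨fun z => f (lift z.1, lift z.2), fun z₀ => ?_⟩, funext fun p =>
    eq_of_circleCover_eq hf (hlift _) (hlift _)⟩
  obtain ⟨L₁, hL₁, h₁⟩ := exists_smooth_lift z₀.1
  obtain ⟨L₂, hL₂, h₂⟩ := exists_smooth_lift z₀.2
  have heq : (fun z : Circle × Circle => f (lift z.1, lift z.2)) =
      fun z => f (L₁ z.1, L₂ z.2) := funext fun z =>
    eq_of_circleCover_eq hf ((hlift _).trans (h₁ _).symm) ((hlift _).trans (h₂ _).symm)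
  rw [heq]
  have k₁ : ContMDiffAt ((𝓡 1).prod (𝓡 1)) 𝓘(ℝ, ℝ) ∞ (fun z : Circle × Circle => L₁ z.1) z₀ :=
    hL₁.comp z₀ contMDiffAt_fst
  have k₂ : ContMDiffAt ((𝓡 1).prod (𝓡 1)) 𝓘(ℝ, ℝ) ∞ (fun z : Circle × Circle => L₂ z.2) z₀ :=
    hL₂.comp z₀ contMDiffAt_snd
  exact ContMDiffAt.comp z₀ (hf.1.contMDiff (L₁ z₀.1, L₂ z₀.2)) (k₁.prodMk_space k₂)

/-- Smooth functions on the torus are the same as smooth doubly periodic functions. -/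
def torusEquiv : SmoothTorus ≃ₐ[ℂ] periodicSmooth :=
  AlgEquiv.ofBijective
    { toFun := fun F => ⟨torusPullback F, torusPullback_mem F⟩
      map_one' := rfl
      map_mul' := fun _ _ => rfl
      map_zero' := rfl
      map_add' := fun _ _ => rfl
      commutes' := fun _ => rfl }
    ⟨fun F G h => by
      ext ⟨z, w⟩
      obtain ⟨s, rfl⟩ := circleCover_surjective z
      obtain ⟨t, rfl⟩ := circleCover_surjective w
      exact congrFun (congrArg Subtype.val h) (s, t),
    fun f => by
      obtain ⟨F, hF⟩ := exists_torusPullback_eq f.2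
      exact ⟨F, Subtype.ext hF⟩⟩

open Topology

/-! ### Sections of a line bundle on the torus -/

/-- The smooth sections of a line bundle of degree `a` on the torus: smooth functions on the plane
that have period `1` in the first variable and the factor of automorphy `exp (2πias)` in the
second one. They form a module over the smooth functions on the torus. -/
def lineBundle (a : ℤ) : Submodule periodicSmooth (ℝ × ℝ → ℂ) where
  carrier := {f | ContDiff ℝ ∞ f ∧ (∀ s t, f (s + 1, t) = f (s, t)) ∧
    ∀ s t, f (s, t + 1) = unitExp (a * s) * f (s, t)}
  zero_mem' := ⟨contDiff_const, fun _ _ => rfl, fun _ _ => (mul_zero _).symm⟩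
  add_mem' hf hg := ⟨hf.1.add hg.1, fun s t => by simp [hf.2.1, hg.2.1],
    fun s t => by simp [hf.2.2, hg.2.2, mul_add]⟩
  smul_mem' c f hf := ⟨(mem_periodicSmooth.1 c.2).1.mul hf.1,
    fun s t => congrArg₂ (· * ·) ((mem_periodicSmooth.1 c.2).2.1 s t) (hf.2.1 s t),
    fun s t => (congrArg₂ (· * ·) ((mem_periodicSmooth.1 c.2).2.2 s t) (hf.2.2 s t)).trans
      (mul_left_comm _ _ _)⟩

/-- A `1`-periodic function vanishing near `c + ℤ` gives a section of the line bundle of degree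
`a`, through the trivialisation of the bundle over the complement of `c + ℤ`. -/
theorem mul_unitExp_floor_mem_lineBundle (a : ℤ) (c : ℝ) {r : ℝ → ℂ} (hr : ContDiff ℝ ∞ r)
    (hp : Function.Periodic r 1) (h0 : ∀ n : ℤ, ∀ᶠ t in 𝓝 (c + n), r t = 0) :
    (fun p : ℝ × ℝ => r p.2 * unitExp (a * ⌊p.2 - c⌋ * p.1)) ∈ lineBundle a := by
  refine ⟨contDiff_iff_contDiffAt.2 fun p => ?_, fun s t => ?_, fun s t => ?_⟩
  · by_cases h : ∃ n : ℤ, p.2 = c + n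
    · obtain ⟨n, hn⟩ := h
      refine (contDiffAt_const (c := (0 : ℂ))).congr_of_eventuallyEq ?_
      have : ∀ᶠ t in 𝓝 p.2, r t = 0 := hn ▸ h0 n
      filter_upwards [continuousAt_snd.eventually this] with x hx
      rw [hx, zero_mul]
    · have hfloor : ∀ᶠ t in 𝓝 p.2, ⌊t - c⌋ = ⌊p.2 - c⌋ := by
        have hlt : (⌊p.2 - c⌋ : ℝ) < p.2 - c := lt_of_le_of_ne (Int.floor_le _) fun he =>
          h ⟨⌊p.2 - c⌋, by linarith⟩
        have hlt' := Int.lt_floor_add_one (p.2 - c)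
        filter_upwards [Ioo_mem_nhds (show c + ⌊p.2 - c⌋ < p.2 by linarith)
          (show p.2 < c + ⌊p.2 - c⌋ + 1 by linarith)] with t ht
        rw [Int.floor_eq_iff]
        constructor <;> linarith [ht.1, ht.2]
      have hd : ContDiff ℝ ∞ fun x : ℝ × ℝ => r x.2 * unitExp (a * ⌊p.2 - c⌋ * x.1) := by fun_prop
      refine hd.contDiffAt.congr_of_eventuallyEq ?_
      filter_upwards [continuousAt_snd.eventually hfloor] with x hx
      rw [hx]
  · beta_reduce
    rw [mul_add, mul_one, ← Int.cast_mul, unitExp_add_intCast]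
  · beta_reduce
    rw [hp, show t + 1 - c = t - c + 1 by ring, Int.floor_add_one, Int.cast_add, Int.cast_one,
      mul_left_comm, ← unitExp_add]
    congr 2
    ring

/-- A smooth `1`-periodic function that vanishes near `c + ℤ` and is positive away from it. -/
def circleBump (c t : ℝ) : ℝ := Real.smoothTransition (1 / 2 - Real.cos (2 * Real.pi * (t - c)))

theorem contDiff_circleBump (c : ℝ) : ContDiff ℝ ∞ (circleBump c) :=
  Real.smoothTransition.contDiff.comp (by fun_prop)

theorem periodic_circleBump (c : ℝ) : Function.Periodic (circleBump c) 1 := fun t => by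
  rw [circleBump, circleBump, ← Real.cos_add_two_pi (2 * Real.pi * (t - c))]
  ring_nf

theorem circleBump_eventually_eq_zero (c : ℝ) (n : ℤ) : ∀ᶠ t in 𝓝 (c + n), circleBump c t = 0 := by
  have hc : Continuous fun t => Real.cos (2 * Real.pi * (t - c)) := by fun_prop
  have h1 : (1 / 2 : ℝ) < Real.cos (2 * Real.pi * (c + n - c)) := by
    rw [show 2 * Real.pi * (c + n - c) = n * (2 * Real.pi) by ring, Real.cos_int_mul_two_pi]
    norm_num
  filter_upwards [hc.continuousAt.eventually (lt_mem_nhds h1)] with t ht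
  exact Real.smoothTransition.zero_of_nonpos (by linarith)

/-- The bump functions at `0` and at `1 / 2` have no common zero. -/
theorem circleBump_sq_add_sq_pos (t : ℝ) : 0 < circleBump 0 t ^ 2 + circleBump (1 / 2) t ^ 2 := by
  have h : Real.cos (2 * Real.pi * (t - 1 / 2)) = -Real.cos (2 * Real.pi * (t - 0)) := by
    rw [← Real.cos_sub_pi]
    ring_nf
  rcases le_total (Real.cos (2 * Real.pi * (t - 0))) 0 with hc | hc
  · have : 0 < circleBump 0 t := Real.smoothTransition.pos_of_pos (by linarith)
    positivity
  · have : 0 < circleBump (1 / 2) t := Real.smoothTransition.pos_of_pos (by rw [h]; linarith)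
    positivity

/-- The line bundle of degree `a` is generated by two sections: there are two sections of it and
two sections of its dual whose pairings add up to `1`. -/
theorem exists_dual_sections (a : ℤ) : ∃ ζ ζ' : Bool → ℝ × ℝ → ℂ, (∀ i, ζ i ∈ lineBundle a) ∧
    (∀ i, ζ' i ∈ lineBundle (-a)) ∧ ∀ p, ∑ i, ζ' i p * ζ i p = 1 := by
  let c : Bool → ℝ := fun i => cond i 0 (1 / 2)
  let D : ℝ → ℝ := fun t => circleBump 0 t ^ 2 + circleBump (1 / 2) t ^ 2
  have hD : ContDiff ℝ ∞ D := ((contDiff_circleBump _).pow 2).add ((contDiff_circleBump _).pow 2)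
  have hpD : Function.Periodic D 1 := fun t => by simp only [D, periodic_circleBump _ t]
  refine ⟨fun i p => (circleBump (c i) p.2 : ℂ) * unitExp (a * ⌊p.2 - c i⌋ * p.1),
    fun i p => ((circleBump (c i) p.2 / D p.2 : ℝ) : ℂ) *
      unitExp ((-a : ℤ) * ⌊p.2 - c i⌋ * p.1), fun i => ?_, fun i => ?_, fun p => ?_⟩
  · refine mul_unitExp_floor_mem_lineBundle a (c i) (r := fun t => (circleBump (c i) t : ℂ))
      (Complex.ofRealCLM.contDiff.comp (contDiff_circleBump _))
      (fun t => by simp only [periodic_circleBump _ t]) fun n => ?_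
    filter_upwards [circleBump_eventually_eq_zero (c i) n] with t ht
    rw [ht, Complex.ofReal_zero]
  · refine mul_unitExp_floor_mem_lineBundle (-a) (c i)
      (r := fun t => ((circleBump (c i) t / D t : ℝ) : ℂ))
      (Complex.ofRealCLM.contDiff.comp
        ((contDiff_circleBump _).div hD fun t => (circleBump_sq_add_sq_pos t).ne'))
      (fun t => by simp only [periodic_circleBump _ t, hpD t]) fun n => ?_
    filter_upwards [circleBump_eventually_eq_zero (c i) n] with t ht
    rw [ht, zero_div, Complex.ofReal_zero]
  · have hterm (i : Bool) : ((circleBump (c i) p.2 / D p.2 : ℝ) : ℂ) *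
        unitExp ((-a : ℤ) * ⌊p.2 - c i⌋ * p.1) *
        ((circleBump (c i) p.2 : ℂ) * unitExp (a * ⌊p.2 - c i⌋ * p.1)) =
        ((circleBump (c i) p.2 ^ 2 / D p.2 : ℝ) : ℂ) := by
      have := unitExp_mul_neg (a * ⌊p.2 - c i⌋ * p.1)
      rw [show ((-a : ℤ) : ℝ) * ⌊p.2 - c i⌋ * p.1 = -(a * ⌊p.2 - c i⌋ * p.1) by push_cast; ring]
      push_cast
      linear_combination (circleBump (c i) p.2 / D p.2 * circleBump (c i) p.2 : ℂ) * this
    simp only [hterm, ← Complex.ofReal_sum]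
    rw [← Finset.sum_div, Fintype.sum_bool]
    exact_mod_cast div_self (circleBump_sq_add_sq_pos p.2).ne'

/-! ### The action of the noncommutative torus on sections -/

theorem sum_unitExp {N : ℕ} (hN : N ≠ 0) (m : ℤ) :
    ∑ k : Fin N, unitExp ((k : ℕ) * (m / N)) = if (N : ℤ) ∣ m then (N : ℂ) else 0 := by
  have hN' : (N : ℝ) ≠ 0 := by exact_mod_cast hN
  have hpow (k : ℕ) : unitExp (k * (m / N)) = unitExp (m / N) ^ k := by
    rw [← zpow_natCast, unitExp_zpow, Int.cast_natCast]
  simp only [hpow]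
  rw [Fin.sum_univ_eq_sum_range (fun k => unitExp (m / N) ^ k)]
  split_ifs with h
  · obtain ⟨n, rfl⟩ := h
    have : unitExp (((N * n : ℤ) : ℝ) / N) = 1 := by
      rw [Int.cast_mul, Int.cast_natCast, mul_div_cancel_left₀ _ hN', unitExp_intCast]
    simp only [this, one_pow, Finset.sum_const, Finset.card_range, nsmul_eq_mul, mul_one]
  · have h1 : unitExp (m / N) ≠ 1 := fun h1 => h <| by
      obtain ⟨n, hn⟩ := (unitExp_eq_one_iff _).1 h1
      rw [div_eq_iff hN'] at hn
      exact ⟨n, by rw [mul_comm]; exact_mod_cast hn⟩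
    have h2 : unitExp (m / N) ^ N = 1 := by
      rw [← hpow, mul_div_cancel₀ _ hN', unitExp_intCast]
    rw [geom_sum_eq h1, h2, sub_self, zero_div]

/-- The operator `f ↦ ∑ α(k, l) exp (2πi(ks + lt/N)) f(s - lb/N, t)`, by which the series
`∑ α(k, l) U^k V^l` acts on functions on the plane. -/
def torusAct (N : ℕ) (b : ℤ) (α : ℤ × ℤ → ℂ) (f : ℝ × ℝ → ℂ) (p : ℝ × ℝ) : ℂ :=
  ∑' x : ℤ × ℤ, α x * unitExp (x.1 * p.1 + x.2 * (p.2 / N)) * f (p.1 - x.2 * (b / N), p.2)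

/-- The coefficients of the part of a series where the exponent of `V` is `j` modulo `N`. -/
def residuePart {N : ℕ} (α : ℤ × ℤ → ℂ) (j : Fin N) (x : ℤ × ℤ) : ℂ := α (x.1, x.2 * N + (j : ℕ))

theorem weight_le_mul_of_le {x y : ℤ × ℤ} {N : ℕ} (h1 : x.1 = y.1)
    (h2 : |(x.2 : ℝ)| ≤ N * |(y.2 : ℝ)| + N) : weight x ≤ (N + 1) * weight y := by
  have hN : (0 : ℝ) ≤ N := N.cast_nonneg
  unfold weight
  rw [h1]
  nlinarith [abs_nonneg (y.1 : ℝ), abs_nonneg (y.2 : ℝ), mul_nonneg hN (abs_nonneg (y.1 : ℝ))]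

theorem abs_le_of_divMod {N : ℕ} (m : ℤ) (j : Fin N) :
    |(m : ℝ)| ≤ N * |((m * N + (j : ℕ) : ℤ) : ℝ)| + N ∧
      |((m * N + (j : ℕ) : ℤ) : ℝ)| ≤ N * |(m : ℝ)| + N := by
  have hj : ((j : ℕ) : ℝ) ≤ N := by exact_mod_cast j.2.le
  have hj0 : (0 : ℝ) ≤ ((j : ℕ) : ℝ) := Nat.cast_nonneg _
  have hN : (1 : ℝ) ≤ N := by exact_mod_cast (Nat.zero_le _).trans_lt j.2
  have h2 : |((m * N + (j : ℕ) : ℤ) : ℝ)| ≤ N * |(m : ℝ)| + N := by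
    push_cast
    refine (abs_add_le _ _).trans ?_
    rw [abs_mul, abs_of_nonneg hj0, abs_of_nonneg (zero_le_one.trans hN), mul_comm]
    linarith
  have h3 : N * |(m : ℝ)| ≤ |((m * N + (j : ℕ) : ℤ) : ℝ)| + N := by
    have := abs_sub_abs_le_abs_sub ((m : ℝ) * N) (-(j : ℕ))
    rw [sub_neg_eq_add, abs_mul, abs_neg, abs_of_nonneg hj0,
      abs_of_nonneg (zero_le_one.trans hN)] at this
    push_cast
    linarith
  refine ⟨?_, h2⟩
  nlinarith [abs_nonneg (m : ℝ), abs_nonneg ((m * N + (j : ℕ) : ℤ) : ℝ)]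

theorem isRapid_of_weight_le {α β : ℤ × ℤ → ℂ} (hα : IsRapid α) (C : ℝ) (g : ℤ × ℤ → ℤ × ℤ)
    (h : ∀ x, ‖β x‖ ≤ ‖α (g x)‖) (hw : ∀ x, weight x ≤ C * weight (g x)) : IsRapid β := by
  refine isRapid_iff.2 fun m => ?_
  obtain ⟨D, hD⟩ := isRapid_iff.1 hα m
  have hC : 0 ≤ C := nonneg_of_mul_nonneg_left ((weight_pos 0).le.trans (hw 0)) (weight_pos _)
  refine ⟨C ^ m * D, fun x => ?_⟩
  calc ‖β x‖ * weight x ^ m ≤ ‖α (g x)‖ * (C * weight (g x)) ^ m :=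
        mul_le_mul (h x) (pow_le_pow_left₀ (weight_pos x).le (hw x) m)
          (pow_pos (weight_pos x) m).le (norm_nonneg _)
    _ = C ^ m * (‖α (g x)‖ * weight (g x) ^ m) := by ring
    _ ≤ C ^ m * D := mul_le_mul_of_nonneg_left (hD _) (pow_nonneg hC m)

theorem isRapid_residuePart {N : ℕ} {α : ℤ × ℤ → ℂ} (hα : IsRapid α) (j : Fin N) :
    IsRapid (residuePart α j) :=
  isRapid_of_weight_le hα (N + 1) (fun x => (x.1, x.2 * N + (j : ℕ))) (fun _ => le_rfl)
    fun x => weight_le_mul_of_le rfl (abs_le_of_divMod x.2 j).1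

theorem exists_residuePart_eq {N : ℕ} [NeZero N] (β : Fin N → ℤ × ℤ → ℂ)
    (hβ : ∀ j, IsRapid (β j)) : ∃ α, IsRapid α ∧ ∀ j, residuePart α j = β j := by
  let e := Int.divModEquiv N
  have he (l : ℤ) : (e l).1 * N + (((e l).2 : Fin N) : ℕ) = l := e.symm_apply_apply l
  have he' (m : ℤ) (j : Fin N) : e (m * N + (j : ℕ)) = (m, j) := e.apply_symm_apply (m, j)
  refine ⟨fun x => β (e x.2).2 (x.1, (e x.2).1), ?_, fun j => funext fun x => ?_⟩
  · have hsum : IsRapid (∑ j, fun x : ℤ × ℤ => (‖β j x‖ : ℂ)) :=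
      Submodule.sum_mem rapid fun j _ =>
        isRapid_of_weight_le (hβ j) 1 id (fun x => by simp) fun x => by simp
    refine isRapid_of_weight_le hsum (N + 1) (fun x => (x.1, (e x.2).1)) (fun x => ?_) fun x => ?_
    · rw [Finset.sum_apply]
      simp only [← Complex.ofReal_sum]
      rw [Complex.norm_real]
      exact (Finset.single_le_sum (f := fun j => ‖β j (x.1, (e x.2).1)‖)
        (fun _ _ => norm_nonneg _) (Finset.mem_univ _)).trans (le_abs_self _)
    · have := (abs_le_of_divMod (e x.2).1 (e x.2).2).2
      rw [he] at this
      exact weight_le_mul_of_le rfl this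
  · simp only [residuePart, he']

theorem apply_add_intCast {f : ℝ × ℝ → ℂ} (hf : ∀ s t, f (s + 1, t) = f (s, t))
    (s t : ℝ) (n : ℤ) : f (s + n, t) = f (s, t) := by
  have : Function.Periodic (fun s => f (s, t)) 1 := fun s => hf s t
  simpa using this.int_mul n s

theorem exists_norm_apply_le {f : ℝ × ℝ → ℂ} (hf : ∀ s t, f (s + 1, t) = f (s, t))
    (hc : Continuous f) (t : ℝ) : ∃ C : ℝ, ∀ s, ‖f (s, t)‖ ≤ C := by
  have hp : Function.Periodic (fun s => f (s, t)) 1 := fun s => hf s t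
  obtain ⟨C, hC⟩ := (hp.isBounded_of_continuous one_ne_zero
    (by fun_prop)).exists_norm_le
  exact ⟨C, fun s => hC _ ⟨s, rfl⟩⟩

theorem summable_torusAct {f : ℝ × ℝ → ℂ} (hf : ∀ s t, f (s + 1, t) = f (s, t))
    (N : ℕ) (b : ℤ) (hc : Continuous f) {α : ℤ × ℤ → ℂ} (hα : IsRapid α)
    (p : ℝ × ℝ) : Summable fun x : ℤ × ℤ =>
      α x * unitExp (x.1 * p.1 + x.2 * (p.2 / N)) * f (p.1 - x.2 * (b / N), p.2) := by
  obtain ⟨C, hC⟩ := exists_norm_apply_le hf hc p.2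
  refine Summable.of_norm_bounded ((summable_norm hα).mul_right C) fun x => ?_
  rw [norm_mul, norm_mul, norm_unitExp, mul_one]
  exact mul_le_mul_of_nonneg_left (hC _) (norm_nonneg _)

/-- Splitting the series according to the residue modulo `N` of the exponent of `V` turns the
action into a finite sum of weighted shifts with smooth periodic weights. -/
theorem torusAct_eq_sum {f : ℝ × ℝ → ℂ} (hf : ∀ s t, f (s + 1, t) = f (s, t))
    {N : ℕ} [NeZero N] (b : ℤ) (hc : Continuous f) {α : ℤ × ℤ → ℂ}
    (hα : IsRapid α) (p : ℝ × ℝ) : torusAct N b α f p =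
      ∑ j : Fin N, fourierSum (residuePart α j) p * unitExp ((j : ℕ) * (p.2 / N)) *
        f (p.1 - (j : ℕ) * (b / N), p.2) := by
  have hN : (N : ℝ) ≠ 0 := NeZero.ne _
  have hs := summable_torusAct hf N b hc hα p
  let e : Fin N × (ℤ × ℤ) ≃ ℤ × ℤ :=
    (Equiv.prodComm _ _).trans ((Equiv.prodAssoc _ _ _).trans
      ((Equiv.refl ℤ).prodCongr (Int.divModEquiv N).symm))
  have he (j : Fin N) (x : ℤ × ℤ) : e (j, x) = (x.1, x.2 * N + (j : ℕ)) := rfl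
  have hse := e.summable_iff.2 hs
  simp only [Function.comp_def] at hse
  rw [torusAct, ← e.tsum_eq, hse.tsum_prod, tsum_fintype]
  refine Finset.sum_congr rfl fun j _ => ?_
  rw [fourierSum, mul_assoc, ← tsum_mul_right]
  refine tsum_congr fun x => ?_
  rw [he, ← mul_assoc, mul_assoc (residuePart α j x), ← unitExp_add]
  have h1 : p.1 - ((x.2 * N + (j : ℕ) : ℤ) : ℝ) * (b / N) =
      p.1 - (j : ℕ) * (b / N) + ((-(x.2 * b) : ℤ) : ℝ) := by
    push_cast
    field_simp
    ring
  have h2 : (x.1 : ℝ) * p.1 + ((x.2 * N + (j : ℕ) : ℤ) : ℝ) * (p.2 / N) =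
      x.1 * p.1 + x.2 * p.2 + (j : ℕ) * (p.2 / N) := by
    push_cast
    field_simp
    ring
  simp only [h1, h2, apply_add_intCast hf, residuePart]

/-- The twisted convolution of coefficients corresponds to the composition of operators. -/
theorem torusAct_twistedConv {f : ℝ × ℝ → ℂ} (hf : ∀ s t, f (s + 1, t) = f (s, t))
    {N : ℕ} {b : ℤ} {q : Circle} (hq : (q : ℂ) = unitExp (b / N))
    (hc : Continuous f) {α β : ℤ × ℤ → ℂ} (hα : IsRapid α) (hβ : IsRapid β) :
    torusAct N b (twistedConv q α β) f = torusAct N b α (torusAct N b β f) := by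
  funext p
  let G : ℤ × ℤ → ℤ × ℤ → ℂ := fun y z =>
    α y * unitExp (y.1 * p.1 + y.2 * (p.2 / N)) *
      (β z * unitExp (z.1 * (p.1 - y.2 * (b / N)) + z.2 * (p.2 / N)) *
        f (p.1 - y.2 * (b / N) - z.2 * (b / N), p.2))
  have hG : Summable (Function.uncurry G) := by
    obtain ⟨C, hC⟩ := exists_norm_apply_le hf hc p.2
    refine Summable.of_norm_bounded (g := fun w : (ℤ × ℤ) × (ℤ × ℤ) => ‖α w.1‖ * ‖β w.2‖ * C)
      (((summable_norm hα).mul_of_nonneg (summable_norm hβ) (fun _ => norm_nonneg _)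
        (fun _ => norm_nonneg _)).mul_right C) ?_
    rintro ⟨y, z⟩
    simp only [Function.uncurry, G, norm_mul, norm_unitExp, mul_one]
    rw [← mul_assoc]
    exact mul_le_mul_of_nonneg_left (hC _) (mul_nonneg (norm_nonneg _) (norm_nonneg _))
  let e : (ℤ × ℤ) × (ℤ × ℤ) ≃ (ℤ × ℤ) × (ℤ × ℤ) :=
    { toFun := fun w => (w.1, w.2 - w.1)
      invFun := fun w => (w.1, w.2 + w.1)
      left_inv := fun w => by simp
      right_inv := fun w => by simp }
  have hG' : Summable (Function.uncurry fun y x => G y (x - y)) := e.summable_iff.2 hG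
  have hR : torusAct N b α (torusAct N b β f) p = ∑' y, ∑' z, G y z := by
    simp only [torusAct, G]
    exact tsum_congr fun y => tsum_mul_left.symm
  have hphase (y z : ℤ × ℤ) : phase q y z = unitExp (-(y.2 * z.1 : ℤ) * (b / N)) := by
    rw [phase, Circle.coe_zpow, hq, unitExp_zpow, Int.cast_neg]
  have hL : torusAct N b (twistedConv q α β) f p = ∑' x, ∑' y, G y (x - y) := by
    simp only [torusAct, twistedConv]
    refine tsum_congr fun x => ?_
    rw [mul_assoc, ← tsum_mul_right]
    refine tsum_congr fun y => ?_
    have h1 : unitExp (-(y.2 * (x - y).1 : ℤ) * (b / N)) *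
        unitExp (x.1 * p.1 + x.2 * (p.2 / N)) = unitExp (y.1 * p.1 + y.2 * (p.2 / N)) *
          unitExp ((x - y).1 * (p.1 - y.2 * (b / N)) + (x - y).2 * (p.2 / N)) := by
      rw [← unitExp_add, ← unitExp_add]
      simp only [Prod.fst_sub, Prod.snd_sub]
      push_cast
      ring_nf
    have h2 : p.1 - y.2 * (b / N) - (x - y).2 * (b / N) = p.1 - x.2 * ((b : ℝ) / N) := by
      simp only [Prod.snd_sub]
      push_cast
      ring
    simp only [G, hphase, h2]
    linear_combination (α y * β (x - y) * f (p.1 - x.2 * (b / N), p.2)) * h1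
  rw [hL, hR, hG'.tsum_comm]
  refine tsum_congr fun y => ?_
  exact (Equiv.subRight y).tsum_eq (G y)

theorem torusAct_one {N : ℕ} {b : ℤ} (f : ℝ × ℝ → ℂ) (c : ℂ) :
    torusAct N b (c • Pi.single 0 1) f = fun p => c * f p := by
  funext p
  rw [torusAct, tsum_eq_single 0 fun x hx => by simp [hx]]
  simp

/-- The action preserves the sections of a line bundle of degree `a`, where `ab ≡ 1` modulo `N`. -/
theorem torusAct_mem {N : ℕ} [NeZero N] {a b v : ℤ} (hab : a * b + v * N = 1) {α : ℤ × ℤ → ℂ}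
    (hα : IsRapid α) {f : ℝ × ℝ → ℂ} (hf : f ∈ lineBundle a) :
    torusAct N b α f ∈ lineBundle a := by
  have hN : (N : ℝ) ≠ 0 := NeZero.ne _
  have hd (j : Fin N) := fourierSum_mem (isRapid_residuePart hα j)
  have heq := funext (torusAct_eq_sum (N := N) hf.2.1 b hf.1.continuous hα)
  rw [heq]
  refine ⟨ContDiff.sum fun j _ => ?_, fun s t => Finset.sum_congr rfl fun j _ => ?_,
    fun s t => ?_⟩
  · have h1 := (hd j).1
    have h2 := hf.1
    fun_prop
  · rw [(hd j).2.1]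
    rw [add_sub_right_comm, hf.2.1]
  · rw [Finset.mul_sum]
    refine Finset.sum_congr rfl fun j _ => ?_
    have h1 : unitExp ((j : ℕ) * ((t + 1) / N)) * unitExp (a * (s - (j : ℕ) * (b / N))) =
        unitExp (a * s) * unitExp ((j : ℕ) * (t / N)) := by
      rw [← unitExp_add, ← unitExp_add, ← unitExp_add_intCast (a * s + _) ((j : ℕ) * v)]
      congr 1
      have hab' : (a : ℝ) * b + v * N = 1 := by exact_mod_cast hab
      push_cast
      field_simp
      linear_combination (-(j : ℕ) : ℝ) * hab'
    simp only [(hd j).2.2, hf.2.2]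
    linear_combination (fourierSum (residuePart α j) (s, t) *
      f (s - (j : ℕ) * (b / N), t)) * h1

theorem dvd_of_dvd_mul {N : ℕ} {a b v m : ℤ} (hab : a * b + v * N = 1) (h : (N : ℤ) ∣ m * b) :
    (N : ℤ) ∣ m := by
  have : m = a * (m * b) + m * v * N := by linear_combination (-m) * hab
  rw [this]
  exact dvd_add (h.mul_left a) (dvd_mul_left _ _)

theorem eq_of_dvd_sub_mul {N : ℕ} {a b v : ℤ} (hab : a * b + v * N = 1) {i j : Fin N}
    (h : (N : ℤ) ∣ (((i : ℕ) : ℤ) - (j : ℕ)) * b) : i = j := by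
  have h1 := dvd_of_dvd_mul hab h
  have hi := i.2
  have hj := j.2
  have := Int.eq_zero_of_abs_lt_dvd h1 (by rw [abs_lt]; omega)
  exact Fin.ext (by omega)

theorem unitExp_mul_mem {a : ℤ} (k : ℤ) {f : ℝ × ℝ → ℂ} (hf : f ∈ lineBundle a) :
    (fun p => unitExp (k * p.1) * f p) ∈ lineBundle a := by
  refine ⟨?_, fun s t => ?_, fun s t => ?_⟩
  · have := hf.1
    fun_prop
  · beta_reduce
    rw [hf.2.1, mul_add, mul_one, unitExp_add_intCast]
  · beta_reduce
    rw [hf.2.2, mul_left_comm]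

theorem mul_mem_periodicSmooth {a : ℤ} {χ f : ℝ × ℝ → ℂ} (hχ : χ ∈ lineBundle (-a))
    (hf : f ∈ lineBundle a) : (fun p => χ p * f p) ∈ periodicSmooth := by
  refine ⟨hχ.1.mul hf.1, fun s t => ?_, fun s t => ?_⟩
  · beta_reduce
    rw [hχ.2.1, hf.2.1]
  · beta_reduce
    rw [hχ.2.2, hf.2.2, mul_mul_mul_comm, ← unitExp_add]
    have : ((-a : ℤ) : ℝ) * s + a * s = 0 := by push_cast; ring
    rw [this, unitExp_zero, one_mul]

/-- The action of the noncommutative torus is faithful: a suitable section is supported, on the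
orbit of a given point under the shifts, at any prescribed element of the orbit. -/
theorem eq_zero_of_torusAct_eq_zero {N : ℕ} [NeZero N] {a b v : ℤ} (hab : a * b + v * N = 1)
    {α : ℤ × ℤ → ℂ} (hα : IsRapid α) (h : ∀ f ∈ lineBundle a, torusAct N b α f = 0) : α = 0 := by
  have hN : (N : ℝ) ≠ 0 := NeZero.ne _
  obtain ⟨ζ, ζ', hζ, -, hsum⟩ := exists_dual_sections a
  have key (j₀ : Fin N) : fourierSum (residuePart α j₀) = 0 := by
    funext p
    -- among the points `(p.1 - jb/N, p.2)`, only at `j = j₀` is the section `f` nonzero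
    let u : ℝ := p.1 - (j₀ : ℕ) * (b / N)
    let f : ℝ × ℝ → ℂ := ∑ k : Fin N, ∑ i, (unitExp (-((k : ℕ) * u)) * ζ' i (u, p.2)) •
      fun x : ℝ × ℝ => unitExp (((k : ℕ) : ℤ) * x.1) * ζ i x
    have hf : f ∈ lineBundle a := Submodule.sum_mem _ fun k _ => Submodule.sum_mem _ fun i _ =>
      Submodule.smul_of_tower_mem _ _ (unitExp_mul_mem _ (hζ i))
    have hval (j : Fin N) : f (p.1 - (j : ℕ) * (b / N), p.2) = if j = j₀ then (N : ℂ) else 0 := by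
      have h1 : f (p.1 - (j : ℕ) * (b / N), p.2) =
          (∑ k : Fin N, unitExp ((k : ℕ) * (((((j₀ : ℕ) : ℤ) - (j : ℕ)) * b : ℤ) / N))) *
            ∑ i, ζ' i (u, p.2) * ζ i (p.1 - (j : ℕ) * (b / N), p.2) := by
        simp only [f, Finset.sum_apply, Pi.smul_apply, smul_eq_mul, Finset.sum_mul, Finset.mul_sum]
        rw [Finset.sum_comm]
        refine Finset.sum_congr rfl fun k _ => Finset.sum_congr rfl fun i _ => ?_
        have h2 : unitExp (-((i : ℕ) * u)) * unitExp (((i : ℕ) : ℤ) * (p.1 - (j : ℕ) * (b / N))) =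
            unitExp ((i : ℕ) * (((((j₀ : ℕ) : ℤ) - (j : ℕ)) * b : ℤ) / N)) := by
          rw [← unitExp_add]
          congr 1
          simp only [u]
          push_cast
          ring
        rw [← h2]
        ring
      rw [h1, sum_unitExp (NeZero.ne N)]
      by_cases hj : j = j₀
      · subst hj
        rw [hsum, sub_self, zero_mul, if_pos (dvd_zero _), if_pos rfl, mul_one]
      · rw [if_neg hj, if_neg fun hd => hj (eq_of_dvd_sub_mul hab hd).symm, zero_mul]
    have h0 := congrFun (h f hf) p
    rw [torusAct_eq_sum hf.2.1 b hf.1.continuous hα] at h0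
    simp only [hval, mul_ite, mul_zero, Finset.sum_ite_eq', Finset.mem_univ, if_true,
      Pi.zero_apply] at h0
    have hne : unitExp ((j₀ : ℕ) * (p.2 / N)) ≠ 0 := fun h' => by
      have := norm_unitExp ((j₀ : ℕ) * (p.2 / N))
      rw [h', norm_zero] at this
      exact zero_ne_one this
    rcases mul_eq_zero.1 h0 with h0 | h0
    · exact (mul_eq_zero.1 h0).resolve_right hne
    · exact absurd h0 (by exact_mod_cast NeZero.ne N)
  have hres (j : Fin N) : residuePart α j = 0 := by
    rw [← fourierCoef_fourierSum (isRapid_residuePart hα j), key j]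
    funext x
    simp [fourierCoef]
  funext x
  have he := (Int.divModEquiv N).symm_apply_apply x.2
  have := congrFun (hres (Int.divModEquiv N x.2).2) (x.1, (Int.divModEquiv N x.2).1)
  exact (congrArg (fun l => α (x.1, l)) he).symm.trans this

/-- The average of a periodic function over the orbits of the shifts by `b / N` in the first
variable, with that variable rescaled so that the result has period `1`. -/
def orbitAverage (N : ℕ) (b : ℤ) (g : ℝ × ℝ → ℂ) (p : ℝ × ℝ) : ℂ :=
  (N : ℂ)⁻¹ * ∑ j : Fin N, g ((p.1 - (j : ℕ) * b) / N, p.2)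

theorem sum_range_sub_eq {N : ℕ} {h : ℤ → ℂ} (hp : ∀ j, h (j + N) = h j) (m : ℤ) :
    ∑ j ∈ Finset.range N, h (j + m) = ∑ j ∈ Finset.range N, h j := by
  let S : ℤ → ℂ := fun m => ∑ j ∈ Finset.range N, h (j + m)
  have hS : Function.Periodic S 1 := fun m => by
    have h1 := Finset.sum_range_succ (fun j : ℕ => h (j + m)) N
    have h2 := Finset.sum_range_succ' (fun j : ℕ => h (j + m)) N
    rw [h1, Nat.cast_zero, zero_add, add_comm (N : ℤ) m, hp] at h2
    rw [add_right_cancel_iff] at h2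
    simp only [S, h2]
    refine Finset.sum_congr rfl fun j _ => ?_
    push_cast
    ring_nf
  have := hS.int_mul m 0
  simpa [S] using this

theorem orbitAverage_mem {N : ℕ} [NeZero N] {a b v : ℤ} (hab : a * b + v * N = 1)
    {g : ℝ × ℝ → ℂ} (hg : g ∈ periodicSmooth) : orbitAverage N b g ∈ periodicSmooth := by
  have hN : (N : ℝ) ≠ 0 := NeZero.ne _
  refine ⟨?_, fun s t => ?_, fun s t => ?_⟩
  · have := hg.1
    unfold orbitAverage
    refine contDiff_const.mul (ContDiff.sum fun j _ => ?_)
    fun_prop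
  · -- replacing `s` by `s + 1` amounts to shifting the summation index by `-a`
    let h : ℤ → ℂ := fun j => g ((s - j * b) / N, t)
    have hp (j : ℤ) : h (j + N) = h j := by
      simp only [h]
      rw [← apply_add_intCast hg.2.1 ((s - j * b) / N) t (-b)]
      congr 2
      push_cast
      field_simp
      ring
    have hshift := sum_range_sub_eq hp (-a)
    simp only [orbitAverage]
    rw [Fin.sum_univ_eq_sum_range (fun j => g ((s + 1 - j * b) / N, t)),
      Fin.sum_univ_eq_sum_range (fun j => g ((s - j * b) / N, t))]
    congr 1
    refine Eq.trans (Finset.sum_congr rfl fun j _ => ?_) hshift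
    simp only [h]
    rw [← apply_add_intCast hg.2.1 ((s - ((j + -a : ℤ) : ℝ) * b) / N) t v]
    congr 2
    have hab' : (a : ℝ) * b + v * N = 1 := by exact_mod_cast hab
    push_cast
    field_simp
    linear_combination -hab'
  · simp only [orbitAverage, hg.2.2]

theorem orbitAverage_mul_left {N : ℕ} [NeZero N] {b : ℤ} (p : ℝ × ℝ) (g : ℝ × ℝ → ℂ) :
    orbitAverage N b g (N * p.1, p.2) =
      (N : ℂ)⁻¹ * ∑ j : Fin N, g (p.1 - (j : ℕ) * (b / N), p.2) := by
  have hN : (N : ℝ) ≠ 0 := NeZero.ne _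
  rw [orbitAverage]
  congr 1
  refine Finset.sum_congr rfl fun j _ => ?_
  congr 2
  field_simp

/-! ### The bimodule -/

/-- The substitution `g(s, t) ↦ g(Ns, t)` in smooth doubly periodic functions. -/
def scaleFst (N : ℕ) : periodicSmooth →+* periodicSmooth where
  toFun g := ⟨fun p => g.1 (N * p.1, p.2), by
    have h1 := (mem_periodicSmooth.1 g.2).1
    fun_prop, fun s t => by
    have := apply_add_intCast (mem_periodicSmooth.1 g.2).2.1 (N * s) t N
    change g.1 (N * (s + 1), t) = g.1 (N * s, t)
    rw [mul_add, mul_one]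
    exact_mod_cast this, fun s t => (mem_periodicSmooth.1 g.2).2.2 _ t⟩
  map_one' := rfl
  map_mul' _ _ := rfl
  map_zero' := rfl
  map_add' _ _ := rfl

/-- The sections of the line bundle of degree `a`, as a module over the smooth functions on the
torus through the `N`-fold covering `(u, w) ↦ (u ^ N, w)`: the sections of a vector bundle of rank
`N`, whose algebra of endomorphisms is the noncommutative torus. -/
def CoverSection (_N : ℕ) (a : ℤ) : Type := lineBundle a

namespace CoverSection

variable {N : ℕ} {a b v : ℤ}

instance : AddCommGroup (CoverSection N a) := inferInstanceAs (AddCommGroup (lineBundle a))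

instance : Module periodicSmooth (CoverSection N a) :=
  Module.compHom (lineBundle a) (scaleFst N)

/-- The function on the plane underlying a section. -/
def fn (f : CoverSection N a) : ℝ × ℝ → ℂ := Subtype.val (p := (· ∈ lineBundle a)) f

theorem fn_mem (f : CoverSection N a) : f.fn ∈ lineBundle a :=
  Subtype.prop (p := (· ∈ lineBundle a)) f

/-- The section with a given underlying function. -/
def mk (f : ℝ × ℝ → ℂ) (hf : f ∈ lineBundle a) : CoverSection N a := (⟨f, hf⟩ : lineBundle a)

@[simp] theorem fn_mk (f : ℝ × ℝ → ℂ) (hf : f ∈ lineBundle a) :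
    (mk f hf : CoverSection N a).fn = f := rfl

theorem ext {f g : CoverSection N a} (h : f.fn = g.fn) : f = g :=
  Subtype.ext (p := (· ∈ lineBundle a)) h

theorem fn_zero : (0 : CoverSection N a).fn = 0 := rfl

theorem fn_add (f g : CoverSection N a) : (f + g).fn = f.fn + g.fn := rfl

theorem fn_sum {ι : Type*} (s : Finset ι) (f : ι → CoverSection N a) :
    (∑ i ∈ s, f i).fn = ∑ i ∈ s, (f i).fn :=
  map_sum (⟨⟨fn, fn_zero⟩, fn_add⟩ : CoverSection N a →+ (ℝ × ℝ → ℂ)) f s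

theorem fn_smul (c : periodicSmooth) (f : CoverSection N a) (p : ℝ × ℝ) :
    (c • f).fn p = c.1 (N * p.1, p.2) * f.fn p := rfl

/-- The transfer of the pairing with a section of the dual line bundle: the function
`f ↦ orbitAverage (χ f)`, which is linear over the functions on the base of the covering. -/
def transfer [NeZero N] (hab : a * b + v * N = 1) {χ : ℝ × ℝ → ℂ} (hχ : χ ∈ lineBundle (-a)) :
    CoverSection N a →ₗ[periodicSmooth] periodicSmooth where
  toFun f := ⟨orbitAverage N b fun p => χ p * f.fn p,
    orbitAverage_mem hab (mul_mem_periodicSmooth hχ f.fn_mem)⟩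
  map_add' f g := Subtype.ext <| funext fun p => by
    simp only [orbitAverage, fn_add, Pi.add_apply, mul_add, Finset.sum_add_distrib]
    rfl
  map_smul' c f := Subtype.ext <| funext fun p => by
    have hN : (N : ℝ) ≠ 0 := NeZero.ne _
    change orbitAverage N b (fun p => χ p * (c • f).fn p) p =
      c.1 p * orbitAverage N b (fun p => χ p * f.fn p) p
    simp only [orbitAverage, fn_smul]
    rw [mul_left_comm]
    congr 1
    rw [Finset.mul_sum]
    refine Finset.sum_congr rfl fun j _ => ?_
    have : c.1 (N * ((p.1 - (j : ℕ) * b) / N), p.2) = c.1 p := by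
      rw [mul_div_cancel₀ _ hN]
      have := apply_add_intCast (mem_periodicSmooth.1 c.2).2.1 p.1 p.2 (-((j : ℕ) * b))
      push_cast at this
      rwa [← sub_eq_add_neg] at this
    rw [this]
    ring

theorem transfer_mul_left [NeZero N] (hab : a * b + v * N = 1) {χ : ℝ × ℝ → ℂ}
    (hχ : χ ∈ lineBundle (-a)) (f : CoverSection N a) (p : ℝ × ℝ) :
    (transfer hab hχ f).1 (N * p.1, p.2) = (N : ℂ)⁻¹ * ∑ j : Fin N,
      (χ (p.1 - (j : ℕ) * (b / N), p.2) * f.fn (p.1 - (j : ℕ) * (b / N), p.2)) :=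
  orbitAverage_mul_left p fun p => χ p * f.fn p

/-- The representation of the noncommutative torus on sections, linear over the functions on the
base of the covering. -/
def torusRep [NeZero N] {q : Circle} (hab : a * b + v * N = 1) (hq : (q : ℂ) = unitExp (b / N)) :
    SmoothQTorus q →+* Module.End periodicSmooth (CoverSection N a) where
  toFun x :=
    { toFun := fun f => mk (torusAct N b x.coeff f.fn) (torusAct_mem hab x.isRapid_coeff f.fn_mem)
      map_add' := fun f g => ext <| funext fun p => by
        change torusAct N b x.coeff (f.fn + g.fn) p = torusAct N b x.coeff f.fn p +
          torusAct N b x.coeff g.fn p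
        rw [torusAct, torusAct, torusAct, ← (summable_torusAct f.fn_mem.2.1 N b
          f.fn_mem.1.continuous x.isRapid_coeff p).tsum_add (summable_torusAct g.fn_mem.2.1 N b
          g.fn_mem.1.continuous x.isRapid_coeff p)]
        exact tsum_congr fun y => mul_add _ _ _
      map_smul' := fun c f => ext <| funext fun p => by
        have hN : (N : ℝ) ≠ 0 := NeZero.ne _
        rw [RingHom.id_apply, fn_smul, fn_mk, fn_mk, torusAct, torusAct, ← tsum_mul_left]
        refine tsum_congr fun y => ?_
        have : c.1 (N * (p.1 - y.2 * (b / N)), p.2) = c.1 (N * p.1, p.2) := by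
          have hshift : N * (p.1 - y.2 * (b / N)) = N * p.1 + ((-(y.2 * b) : ℤ) : ℝ) := by
            push_cast
            field_simp
            ring
          rw [hshift, apply_add_intCast (mem_periodicSmooth.1 c.2).2.1]
        rw [fn_smul, this]
        ring }
  map_one' := LinearMap.ext fun f => ext <| by
    have := torusAct_one (N := N) (b := b) f.fn 1
    simp only [one_smul, one_mul] at this
    exact this
  map_mul' x y := LinearMap.ext fun f => ext <|
    torusAct_twistedConv f.fn_mem.2.1 hq f.fn_mem.1.continuous x.isRapid_coeff y.isRapid_coeff
  map_zero' := LinearMap.ext fun f => ext <| funext fun p => by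
    change torusAct N b 0 f.fn p = 0
    simp [torusAct]
  map_add' x y := LinearMap.ext fun f => ext <| funext fun p => by
    change torusAct N b (x.coeff + y.coeff) f.fn p = torusAct N b x.coeff f.fn p +
      torusAct N b y.coeff f.fn p
    have hs (z : SmoothQTorus q) := summable_torusAct f.fn_mem.2.1 N b f.fn_mem.1.continuous
      z.isRapid_coeff p
    rw [torusAct, torusAct, torusAct, ← (hs x).tsum_add (hs y)]
    exact tsum_congr fun z => by rw [Pi.add_apply, add_mul, add_mul]

theorem torusRep_apply [NeZero N] {q : Circle} (hab : a * b + v * N = 1)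
    (hq : (q : ℂ) = unitExp (b / N)) (x : SmoothQTorus q) (f : CoverSection N a) :
    (torusRep hab hq x f).fn = torusAct N b x.coeff f.fn := rfl

theorem torusRep_injective [NeZero N] {q : Circle} (hab : a * b + v * N = 1)
    (hq : (q : ℂ) = unitExp (b / N)) : Function.Injective (torusRep hab hq) := by
  rw [injective_iff_map_eq_zero]
  intro x hx
  have : x.coeff = 0 := eq_zero_of_torusAct_eq_zero hab x.isRapid_coeff fun f hf =>
    congrArg fn (LinearMap.congr_fun hx (mk f hf))
  exact SmoothQTorus.ext (congrFun this)

theorem torusRep_algebraMap [NeZero N] {q : Circle} (hab : a * b + v * N = 1)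
    (hq : (q : ℂ) = unitExp (b / N)) (c : ℂ) (f : CoverSection N a) :
    torusRep hab hq (algebraMap ℂ (SmoothQTorus q) c) f = algebraMap ℂ periodicSmooth c • f := by
  refine ext ?_
  rw [torusRep_apply, Algebra.algebraMap_eq_smul_one, SmoothQTorus.coeff_smul,
    SmoothQTorus.coeff_one, torusAct_one]
  rfl

/-- The rank one operators `y ↦ transfer χ y • f` belong to the noncommutative torus: the average
over the orbit is a sum of weighted shifts, with weights built from `f` and `χ`. -/
theorem exists_torusRep_eq_transfer_smul [NeZero N] {q : Circle} (hab : a * b + v * N = 1)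
    (hq : (q : ℂ) = unitExp (b / N)) {χ : ℝ × ℝ → ℂ} (hχ : χ ∈ lineBundle (-a))
    (f : CoverSection N a) :
    ∃ x : SmoothQTorus q, ∀ y, torusRep hab hq x y = transfer hab hχ y • f := by
  have hN : (N : ℝ) ≠ 0 := NeZero.ne _
  let d : Fin N → ℝ × ℝ → ℂ := fun j p => (N : ℂ)⁻¹ * f.fn p *
    χ (p.1 - (j : ℕ) * (b / N), p.2) * unitExp (-((j : ℕ) * (p.2 / N)))
  have hd (j : Fin N) : d j ∈ periodicSmooth := by
    refine ⟨?_, fun s t => ?_, fun s t => ?_⟩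
    · have h1 := f.fn_mem.1
      have h2 := hχ.1
      simp only [d]
      fun_prop
    · simp only [d]
      rw [f.fn_mem.2.1, add_sub_right_comm, hχ.2.1]
    · simp only [d]
      rw [f.fn_mem.2.2, hχ.2.2]
      have h1 : unitExp (a * s) * unitExp ((-a : ℤ) * (s - (j : ℕ) * (b / N))) *
          unitExp (-((j : ℕ) * ((t + 1) / N))) = unitExp (-((j : ℕ) * (t / N))) := by
        rw [← unitExp_add, ← unitExp_add,
          ← unitExp_add_intCast (-((j : ℕ) * (t / N))) (-((j : ℕ) * v))]
        congr 1
        have hab' : (a : ℝ) * b + v * N = 1 := by exact_mod_cast hab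
        push_cast
        field_simp
        linear_combination ((j : ℕ) : ℝ) * hab'
      linear_combination ((N : ℂ)⁻¹ * f.fn (s, t) * χ (s - (j : ℕ) * (b / N), t)) * h1
  obtain ⟨α, hα, hres⟩ := exists_residuePart_eq (fun j => fourierCoef (d j))
    fun j => isRapid_fourierCoef (hd j)
  refine ⟨SmoothQTorus.mk α hα, fun y => ext <| funext fun p => ?_⟩
  rw [torusRep_apply, SmoothQTorus.coeff_mk, fn_smul, transfer_mul_left,
    torusAct_eq_sum y.fn_mem.2.1 b y.fn_mem.1.continuous hα, mul_assoc, Finset.sum_mul,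
    Finset.mul_sum]
  refine Finset.sum_congr rfl fun j _ => ?_
  rw [hres, fourierSum_fourierCoef (hd j)]
  have h1 := unitExp_mul_neg ((j : ℕ) * (p.2 / N))
  simp only [d]
  linear_combination ((N : ℂ)⁻¹ * f.fn p * χ (p.1 - (j : ℕ) * (b / N), p.2) *
    y.fn (p.1 - (j : ℕ) * (b / N), p.2)) * h1

/-- The sections are finitely generated projective over the functions on the base of the covering,
and a generator: there is a dual basis whose trace `∑ φ i (p i)` is the rank `N`. -/
theorem exists_dual_basis [NeZero N] (hab : a * b + v * N = 1) :
    ∃ (χ : Fin N × Bool → lineBundle (-a)) (p : Fin N × Bool → CoverSection N a),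
      (∀ f, ∑ i, transfer hab (χ i).2 f • p i = f) ∧ ∑ i, transfer hab (χ i).2 (p i) = N := by
  have hN : (N : ℝ) ≠ 0 := NeZero.ne _
  have hN' : (N : ℂ) ≠ 0 := NeZero.ne _
  obtain ⟨ζ, ζ', hζ, hζ', hsum⟩ := exists_dual_sections a
  refine ⟨fun i => ⟨_, unitExp_mul_mem (-((i.1 : ℕ) : ℤ)) (hζ' i.2)⟩,
    fun i => mk _ (unitExp_mul_mem ((i.1 : ℕ) : ℤ) (hζ i.2)), fun f => ?_, ?_⟩
  · refine ext <| funext fun p => ?_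
    rw [fn_sum, Finset.sum_apply]
    simp only [fn_smul, transfer_mul_left, fn_mk]
    let g (j : Fin N) : ℂ := (N : ℂ)⁻¹ * f.fn (p.1 - (j : ℕ) * (b / N), p.2)
    have hterm (i : Fin N × Bool) :
        (N : ℂ)⁻¹ * (∑ j : Fin N, unitExp ((-((i.1 : ℕ) : ℤ) : ℤ) * (p.1 - (j : ℕ) * (b / N))) *
          ζ' i.2 (p.1 - (j : ℕ) * (b / N), p.2) * f.fn (p.1 - (j : ℕ) * (b / N), p.2)) *
          (unitExp (((i.1 : ℕ) : ℤ) * p.1) * ζ i.2 p) =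
        ∑ j : Fin N, unitExp ((i.1 : ℕ) * (((((j : ℕ) : ℤ) * b : ℤ) : ℝ) / N)) *
          (g j * (ζ' i.2 (p.1 - (j : ℕ) * (b / N), p.2) * ζ i.2 p)) := by
      rw [mul_assoc, Finset.sum_mul, Finset.mul_sum]
      refine Finset.sum_congr rfl fun j _ => ?_
      have h1 : unitExp ((-((i.1 : ℕ) : ℤ) : ℤ) * (p.1 - (j : ℕ) * (b / N))) *
          unitExp (((i.1 : ℕ) : ℤ) * p.1) =
            unitExp ((i.1 : ℕ) * (((((j : ℕ) : ℤ) * b : ℤ) : ℝ) / N)) := by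
        rw [← unitExp_add]
        congr 1
        push_cast
        ring
      simp only [g]
      rw [← h1]
      ring
    simp only [hterm]
    rw [Finset.sum_comm]
    simp only [Fintype.sum_prod_type_right, ← Finset.sum_mul, sum_unitExp (NeZero.ne N)]
    simp only [← Finset.mul_sum]
    have hsum' := hsum p
    rw [Fintype.sum_bool] at hsum'
    rw [Finset.sum_eq_single 0]
    · simp [g, hsum', hN']
    · intro j _ hj
      rw [if_neg, zero_mul]
      intro hd
      exact hj (eq_of_dvd_sub_mul hab (by simpa using hd))
    · simp
  · refine Subtype.ext <| funext fun p => ?_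
    have hp : p = (N * (p.1 / N), p.2) := by rw [mul_div_cancel₀ _ hN]
    let u (j : Fin N) : ℝ × ℝ := (p.1 / N - (j : ℕ) * (b / N), p.2)
    have hterm (i : Fin N × Bool) : (transfer hab (unitExp_mul_mem (-((i.1 : ℕ) : ℤ)) (hζ' i.2))
        (mk _ (unitExp_mul_mem ((i.1 : ℕ) : ℤ) (hζ i.2)) : CoverSection N a)).1 p =
        (N : ℂ)⁻¹ * ∑ j, ζ' i.2 (u j) * ζ i.2 (u j) := by
      rw [hp]
      refine (transfer_mul_left hab _ _ (p.1 / N, p.2)).trans (congrArg _ ?_)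
      refine Finset.sum_congr rfl fun j _ => ?_
      have := unitExp_mul_neg (((i.1 : ℕ) : ℤ) * (u j).1)
      simp only [fn_mk]
      rw [Int.cast_neg, neg_mul]
      linear_combination (ζ' i.2 (u j) * ζ i.2 (u j)) * this
    rw [AddSubmonoidClass.coe_finsetSum, Finset.sum_apply]
    refine (Finset.sum_congr rfl fun i _ => hterm i).trans ?_
    rw [← Finset.mul_sum, Finset.sum_comm]
    simp only [Fintype.sum_prod_type, hsum, Finset.sum_const, Finset.card_univ, Fintype.card_fin,
      nsmul_eq_mul, mul_one]
    exact inv_mul_cancel_left₀ hN' _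

end CoverSection

/-- For `q = exp (2πib/N)` with `b` prime to `N`, the sections of a line bundle of degree inverse to
`b` modulo `N` give a Morita equivalence. -/
theorem isMoritaEquivalent_periodicSmooth {N : ℕ} [NeZero N] {a b v : ℤ} {q : Circle}
    (hab : a * b + v * N = 1) (hq : (q : ℂ) = unitExp (b / N)) :
    IsMoritaEquivalent ℂ (SmoothQTorus q) periodicSmooth := by
  let ρ := CoverSection.torusRep hab hq
  let : Module (SmoothQTorus q) (CoverSection N a) := Module.compHom _ ρ
  have hsmul (x : SmoothQTorus q) (f : CoverSection N a) : x • f = ρ x f := rfl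
  have : SMulCommClass periodicSmooth (SmoothQTorus q) (CoverSection N a) :=
    ⟨fun c x f => ((ρ x).map_smul c f).symm⟩
  have : FaithfulSMul (SmoothQTorus q) (CoverSection N a) :=
    ⟨fun h => CoverSection.torusRep_injective hab hq (LinearMap.ext h)⟩
  obtain ⟨χ, p, hp, htr⟩ := CoverSection.exists_dual_basis (N := N) hab
  refine IsMoritaEquivalent.of_bimodule (P := CoverSection N a) (p := p)
    (φ := fun i => CoverSection.transfer hab (χ i).2)
    (r := fun i => algebraMap ℂ periodicSmooth (N : ℂ)⁻¹ • p i) ℂ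
    (CoverSection.torusRep_algebraMap hab hq) hp ?_
    fun i f => CoverSection.exists_torusRep_eq_transfer_smul hab hq (χ i).2 f
  simp only [map_smul]
  rw [← Finset.smul_sum, htr, smul_eq_mul, ← map_natCast (algebraMap ℂ periodicSmooth), ← map_mul,
    inv_mul_cancel₀ (NeZero.ne _), map_one]

end NCT

end

theorem corollary2p3 (N : ℕ) (hN : 0 < N) (q : Circle) (hq : IsPrimitiveRoot (q : ℂ) N) :
    IsMoritaEquivalent ℂ (NCT.SmoothQTorus q) NCT.SmoothTorus := by
  obtain ⟨b, -, hb, hbq⟩ := (Complex.isPrimitiveRoot_iff _ N hN.ne').1 hq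
  obtain ⟨a, v, hab⟩ := Nat.isCoprime_iff_coprime.2 hb
  have : NeZero N := ⟨hN.ne'⟩
  have hq' : (q : ℂ) = NCT.unitExp ((b : ℤ) / N) := by
    rw [← hbq, NCT.unitExp]
    push_cast
    rfl
  exact (NCT.isMoritaEquivalent_periodicSmooth hab hq').trans ℂ
    (IsMoritaEquivalent.of_algEquiv ℂ NCT.torusEquiv.symm)
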